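/- Let $d,\kappa\ge 1$ be integers and $0<\varepsilon\le 1$. For $k=1,\dots,\kappa$ let $U_k=\sum_{x}|x+k\rangle\langle x|$ be the cyclic shift on $\mathbb C^d$ (addition mod $d$). For a unit vector $|\alpha\rangle\in\mathbb C^d$ write $$|\beta\rangle=\frac1{\sqrt\kappa}\sum_{k=1}^{\kappa}|k\rangle\,U_k|\alpha\rangle=\sum_{x=1}^d\beta_x\,|b_x\rangle|x\rangle ,\qquad \beta_x\ge 0,\quad |b_x\rangle\in\mathbb C^\kappa \text{ a unit vector}$$ (with $|b_x\rangle$ a fixed basis vector if $\beta_x=0$). Consider the following protocol by which Alice, who knows $|\alpha\rangle$, prepares it in the laboratory of Bob, who does not. (1) They start with $|\Phi_d\rangle=\frac1{\sqrt d}\sum_x|x\rangle^A|x\rangle^B$ ($\log_2 d$ ebits). (2) Alice applies the local isometry $|x\rangle^A\mapsto|x\rangle^A|b_x\rangle^{A'}$. (3) They apply the coherent erasure map $|x\rangle^A|x\rangle^B\mapsto|x\rangle^B$, which is defined on the span of the vectors $|x\rangle^A|x\rangle^B$ ($\log_2 d$ co-cobits from Alice to Bob). (4) Alice sends the $\kappa$-dimensional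 register $A'$ to Bob ($\log_2\kappa$ qubits). (5) Bob applies $\sum_k|k\rangle\langle k|\otimes U_k^\dagger$ and discards $A'$, which leaves him with a density matrix $\rho_\alpha$ on $\mathbb C^d$. Theorem. This protocol uses exactly $\log_2 d$ co-cobits, $\log_2 d$ ebits and $\log_2\kappa$ qubits from Alice to Bob, and there is a subspace $V\subset\mathbb C^d$ of dimension $$\dim V=\left\lfloor\frac{d\,\varepsilon^2}{32\,\ln(5/\varepsilon)}\right\rfloor$$ such that for every unit vector $|\alpha\rangle\in V$ coherent erasure is only applied to states in its domain (tensored with other registers), and the state prepared in Bob's laboratory has fidelity $$F(\alpha,\rho_\alpha)=\sqrt{\langle\alpha|\rho_\alpha|\alpha\rangle}\;\ge\;1-\frac1{2\kappa}-2\varepsilon .$$ -/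

import Mathlib

open scoped Matrix ComplexConjugate

namespace RemotePrep

/-- Two-party one-shot protocols.  A term of `Protocol ι a b` is a protocol that starts from nothing
and ends with Alice holding a register with basis `a` and Bob holding a register with basis `b`.
The type `ι` is the range of a classical datum known to Alice but not to Bob: Alice's local
isometries may depend on it, nothing else may. -/
inductive Protocol (ι : Type) : (a b : Type) → Type 1
  /-- Empty registers on both sides. -/
  | start : Protocol ι Unit Unit
  /-- Alice applies a local isometry, chosen according to her datum. -/
  | alice {a a' b : Type} [Fintype a] [DecidableEq a] [Fintype a'] (P : Protocol ι a b)
      (W : ι → Matrix a' a ℂ) (hW : ∀ i, (W i)ᴴ * W i = 1) : Protocol ι a' b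
  /-- Bob applies a local isometry. -/
  | bob {a b b' : Type} [Fintype b] [DecidableEq b] [Fintype b'] (P : Protocol ι a b)
      (W : Matrix b' b ℂ) (hW : Wᴴ * W = 1) : Protocol ι a b'
  /-- The parties are given the state `n^{-1/2} ∑ x, |x⟩|x⟩`, that is, `log₂ n` ebits. -/
  | ebits {a b : Type} (n : ℕ) (P : Protocol ι a b) : Protocol ι (a × Fin n) (b × Fin n)
  /-- Coherent erasure `|x⟩|x⟩ ↦ |x⟩` of Alice's copy: `log₂ n` co-cobits from Alice to Bob. -/
  | coCobits {a b : Type} (n : ℕ) (P : Protocol ι (a × Fin n) (b × Fin n)) :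
      Protocol ι a (b × Fin n)
  /-- Alice sends an `n`-dimensional system to Bob: `log₂ n` qubits. -/
  | qubits {a b : Type} (n : ℕ) (P : Protocol ι (a × Fin n) b) : Protocol ι a (b × Fin n)

namespace Protocol

variable {ι : Type}

/-- Amplitudes of the joint pure state at the end of the protocol. -/
noncomputable def state : {a b : Type} → Protocol ι a b → ι → a × b → ℂ
  | _, _, start, _ => fun _ => 1
  | _, _, @alice _ a _ _ _ _ _ P W _, i => fun p => ∑ x : a, W i p.1 x * P.state i (x, p.2)
  | _, _, @bob _ _ b _ _ _ _ P W _, i => fun p => ∑ y : b, W p.2 y * P.state i (p.1, y)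
  | _, _, ebits n P, i => fun p =>
      P.state i (p.1.1, p.2.1) * (if p.1.2 = p.2.2 then ((Real.sqrt n)⁻¹ : ℂ) else 0)
  | _, _, coCobits _ P, i => fun p => P.state i ((p.1, p.2.2), p.2)
  | _, _, qubits _ P, i => fun p => P.state i ((p.1, p.2.2), p.2.1)

/-- Coherent erasure is only defined on the span of the states `|x⟩|x⟩` (tensored with anything
else); a run is valid if all its uses of coherent erasure respect this. -/
def Valid : {a b : Type} → Protocol ι a b → ι → Prop
  | _, _, start, _ => True
  | _, _, alice P _ _, i => P.Valid i
  | _, _, bob P _ _, i => P.Valid i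
  | _, _, ebits n P, i => 0 < n ∧ P.Valid i
  | _, _, coCobits _ P, i =>
      P.Valid i ∧ ∀ r s x y, x ≠ y → P.state i ((r, x), (s, y)) = 0
  | _, _, qubits _ P, i => P.Valid i

/-- Number of ebits consumed. -/
noncomputable def ebitCost : {a b : Type} → Protocol ι a b → ℝ
  | _, _, start => 0
  | _, _, alice P _ _ => P.ebitCost
  | _, _, bob P _ _ => P.ebitCost
  | _, _, ebits n P => P.ebitCost + Real.logb 2 n
  | _, _, coCobits _ P => P.ebitCost
  | _, _, qubits _ P => P.ebitCost

/-- Number of co-cobits (from Alice to Bob) consumed. -/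
noncomputable def coCobitCost : {a b : Type} → Protocol ι a b → ℝ
  | _, _, start => 0
  | _, _, alice P _ _ => P.coCobitCost
  | _, _, bob P _ _ => P.coCobitCost
  | _, _, ebits _ P => P.coCobitCost
  | _, _, coCobits n P => P.coCobitCost + Real.logb 2 n
  | _, _, qubits _ P => P.coCobitCost

/-- Number of qubits sent from Alice to Bob. -/
noncomputable def qubitCost : {a b : Type} → Protocol ι a b → ℝ
  | _, _, start => 0
  | _, _, alice P _ _ => P.qubitCost
  | _, _, bob P _ _ => P.qubitCost
  | _, _, ebits _ P => P.qubitCost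
  | _, _, coCobits _ P => P.qubitCost
  | _, _, qubits n P => P.qubitCost + Real.logb 2 n

/-- Bob's density matrix on the first factor of his final register: Alice's register and the
second factor of Bob's register are traced out. -/
noncomputable def bobOutput {a n m : Type} [Fintype a] [Fintype m] (P : Protocol ι a (n × m))
    (i : ι) : Matrix n n ℂ :=
  Matrix.of fun x y => ∑ r : a, ∑ k : m, P.state i (r, (x, k)) * conj (P.state i (r, (y, k)))

end Protocol

/-- The (square-root) fidelity `√⟨φ|ρ|φ⟩` of a density matrix with a pure state. -/
noncomputable def fidelity {n : Type} [Fintype n] (φ : EuclideanSpace ℂ n) (ρ : Matrix n n ℂ) : ℝ :=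
  Real.sqrt (∑ x, ∑ y, conj (φ x) * ρ x y * φ y).re

variable {d κ : ℕ}

/-- The unnormalised vector `β_x |b_x⟩ ∈ ℂ^κ`, where
`|β⟩ = κ^{-1/2} ∑ k, |k⟩ U_k |α⟩ = ∑ x, β_x |b_x⟩ |x⟩`. -/
noncomputable def block (U : Fin κ → Matrix.unitaryGroup (Fin d) ℂ)
    (α : EuclideanSpace ℂ (Fin d)) (x : Fin d) : EuclideanSpace ℂ (Fin κ) :=
  WithLp.toLp 2 fun k => ((Real.sqrt κ)⁻¹ : ℂ) * ((U k : Matrix (Fin d) (Fin d) ℂ) *ᵥ α.ofLp) x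

/-- The unit vector `|b_x⟩`, normalised so that `β_x = ‖block U α x‖ ≥ 0`; where `β_x = 0` it is
a fixed basis vector. -/
noncomputable def bVec [NeZero κ] (U : Fin κ → Matrix.unitaryGroup (Fin d) ℂ)
    (α : EuclideanSpace ℂ (Fin d)) (x : Fin d) : EuclideanSpace ℂ (Fin κ) :=
  open Classical in
  if block U α x = 0 then EuclideanSpace.single 0 1
  else ((‖block U α x‖ : ℂ)⁻¹) • block U α x

theorem norm_bVec [NeZero κ] (U : Fin κ → Matrix.unitaryGroup (Fin d) ℂ)
    (α : EuclideanSpace ℂ (Fin d)) (x : Fin d) : ‖bVec U α x‖ = 1 := by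
  unfold bVec
  split_ifs with h
  · simp
  · rw [norm_smul, norm_inv, Complex.norm_real, norm_norm]
    exact inv_mul_cancel₀ (norm_ne_zero_iff.2 h)

/-- Alice's encoding `|x⟩^A ↦ |b_x⟩^{A'} |x⟩^A`. -/
noncomputable def encode [NeZero κ] (U : Fin κ → Matrix.unitaryGroup (Fin d) ℂ)
    (α : EuclideanSpace ℂ (Fin d)) : Matrix ((Unit × Fin κ) × Fin d) (Unit × Fin d) ℂ :=
  Matrix.of fun p q => if p.2 = q.2 then bVec U α q.2 p.1.2 else 0

theorem encode_isometry [NeZero κ] (U : Fin κ → Matrix.unitaryGroup (Fin d) ℂ)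
    (α : EuclideanSpace ℂ (Fin d)) : (encode U α)ᴴ * encode U α = 1 := by
  ext ⟨_, x⟩ ⟨_, y⟩
  simp only [Matrix.mul_apply, Matrix.conjTranspose_apply, encode, Matrix.of_apply,
    Fintype.sum_prod_type, Finset.univ_unique, Finset.sum_singleton, Matrix.one_apply]
  by_cases h : x = y
  · subst h
    have h1 := norm_bVec U α x
    rw [EuclideanSpace.norm_eq, Real.sqrt_eq_one] at h1
    simp only [apply_ite (star : ℂ → ℂ), star_zero, mul_ite, mul_zero, ite_mul, zero_mul,
      if_true, Finset.sum_ite_eq', Finset.mem_univ]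
    calc _ = ∑ k, ((‖bVec U α x k‖ ^ 2 : ℝ) : ℂ) := by
          refine Finset.sum_congr rfl fun k _ => ?_
          simp [← Complex.conj_mul']
      _ = 1 := by rw [← Complex.ofReal_sum, h1, Complex.ofReal_one]
  · have hne : ((PUnit.unit, x) : Unit × Fin d) ≠ (PUnit.unit, y) := fun e => h (Prod.ext_iff.1 e).2
    rw [if_neg hne]
    refine Finset.sum_eq_zero fun k _ => Finset.sum_eq_zero fun z _ => ?_
    by_cases hz : z = x
    · simp [hz, h]
    · simp [hz]

/-- Bob's decoding `∑ k, U_k† ⊗ |k⟩⟨k|`, which maps `|β⟩` to `|α⟩ ⊗ κ^{-1/2} ∑ k, |k⟩`. -/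
noncomputable def decode (U : Fin κ → Matrix.unitaryGroup (Fin d) ℂ) :
    Matrix (Fin d × Fin κ) ((Unit × Fin d) × Fin κ) ℂ :=
  Matrix.of fun p q =>
    if p.2 = q.2 then (U p.2 : Matrix (Fin d) (Fin d) ℂ)ᴴ p.1 q.1.2 else 0

theorem decode_isometry (U : Fin κ → Matrix.unitaryGroup (Fin d) ℂ) :
    (decode U)ᴴ * decode U = 1 := by
  ext ⟨⟨_, x⟩, k⟩ ⟨⟨_, y⟩, l⟩
  simp only [Matrix.mul_apply, Matrix.conjTranspose_apply, decode, Matrix.of_apply,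
    Fintype.sum_prod_type]
  by_cases h : k = l
  · subst h
    have hU : (U k : Matrix (Fin d) (Fin d) ℂ) * (U k : Matrix (Fin d) (Fin d) ℂ)ᴴ = 1 :=
      Matrix.mem_unitaryGroup_iff.1 (U k).2
    have := congrFun (congrFun hU x) y
    simp only [Matrix.mul_apply, Matrix.conjTranspose_apply] at this
    simpa [Matrix.one_apply, apply_ite (star : ℂ → ℂ)] using this
  · have hne : (((PUnit.unit, x), k) : (Unit × Fin d) × Fin κ) ≠ ((PUnit.unit, y), l) :=
      fun e => h (Prod.ext_iff.1 e).2
    rw [Matrix.one_apply_ne hne]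
    refine Finset.sum_eq_zero fun i _ => Finset.sum_eq_zero fun m _ => ?_
    by_cases hm : m = k
    · simp [hm, h]
    · simp [hm]

/-- Remote state preparation by coherent erasure.  Alice knows `α`.  Starting from `|Φ_d⟩` she
applies `encode`, coherently erases her `d`-dimensional register, and sends the `κ`-dimensional
ancilla to Bob, who applies `decode`. -/
noncomputable def rsp [NeZero κ] (U : Fin κ → Matrix.unitaryGroup (Fin d) ℂ) :
    Protocol (EuclideanSpace ℂ (Fin d)) Unit (Fin d × Fin κ) :=
  .bob (.qubits κ (.coCobits d (.alice (.ebits d .start) (encode U) (encode_isometry U))))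
    (decode U) (decode_isometry U)

/-- The cyclic shift `∑ x, |x + s⟩⟨x|`, with addition modulo `d`. -/
def shift [NeZero d] (s : Fin d) : Matrix.unitaryGroup (Fin d) ℂ :=
  ⟨Matrix.of fun x y => if x = y + s then 1 else 0, by
    rw [Matrix.mem_unitaryGroup_iff']
    ext x y
    simp [Matrix.mul_apply, Matrix.star_apply, Matrix.one_apply, apply_ite (star : ℂ → ℂ), eq_comm]⟩

/-- The unitaries `U_1, …, U_κ`, where `U_k` shifts by `k`; the index `k : Fin κ` stands for the
integer `k + 1`. -/
def shifts (d κ : ℕ) [NeZero d] : Fin κ → Matrix.unitaryGroup (Fin d) ℂ :=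
  fun k => shift (Fin.ofNat d (k.val + 1))

end RemotePrep

/-! After erasure Bob and `A'` hold d^{-1/2} ∑ |b_x⟩|x⟩ instead of |β⟩ = ∑ β_x |b_x⟩|x⟩, and the
overlap of the two is d^{-1/2} ∑ β_x. Decoding maps |β⟩ to |α⟩ times a fixed ancilla state, so this
overlap bounds the fidelity from below (`overlap_le_fidelity`). It remains to find a large subspace
on whose unit sphere the overlap is nearly 1.

As a function of α, the overlap is subadditive and positively homogeneous, and it is at most ‖α‖.
Its mean over the sphere is at least 1 - 1/(2κ) (`one_sub_le_integral_overlap`): dβ_x² is an average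
of |α_j|² d over κ cyclic shifts, has mean 1, and has variance at most 1/κ by a fourth moment
computation on the unitary group. The claim is then Dvoretzky's theorem in Milman's style
(`exists_submodule_forall_le`). One ε is lost to concentration of measure, the other in passing from
single vectors to all unit vectors of a subspace.

Concentration is proved for the Gaussian measure by the Maurey–Pisier rotation argument
(`IsNorming.integral_exp_sub_le`) and carried to Haar-random vectors through cones, whose measure
does not depend on the radial law. The net is replaced by a comparison of volumes
(`exists_unitary_forall_le`). -/

open MeasureTheory ProbabilityTheory Filter Topology

namespace RemotePrep

/-! ### Norming functionals and rotations of a pair of vectors -/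

section Gaussian

variable {E : Type*} [NormedAddCommGroup E] [NormedSpace ℝ E]

/-- `F` is the supremum of a family of functionals of norm at most one, attained everywhere. -/
def IsNorming (F : E → ℝ) : Prop :=
  Continuous F ∧ ∀ x, ∃ g : StrongDual ℝ E, ‖g‖ ≤ 1 ∧ (∀ z, g z ≤ F z) ∧ g x = F x

theorem isNorming_norm :
    IsNorming (fun x : E => ‖x‖) := by
  refine ⟨continuous_norm, fun x => ?_⟩
  obtain ⟨g, hg, hx⟩ := exists_dual_vector'' ℝ x
  refine ⟨g, hg, fun z => ?_, by simpa using hx⟩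
  exact (le_abs_self _).trans ((g.le_of_opNorm_le hg z).trans_eq (one_mul _))

theorem IsNorming.abs_le_norm {F : E → ℝ}
    (hF : IsNorming F) (x : E) : |F x| ≤ ‖x‖ := by
  obtain ⟨g, hg, -, hx⟩ := hF.2 x
  rw [← hx]
  exact (g.le_of_opNorm_le hg x).trans_eq (one_mul _)

/-- Every step along the path from `z.1` to `z.2` is the same small rotation, applied to an already
rotated pair. Since the law of a Gaussian pair is rotation invariant, all steps have the same
distribution. -/
theorem rotation_step (θ δ : ℝ) (z : E × E) :
    (ContinuousLinearMap.rotation (θ + δ) z).1 =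
      Real.cos δ • (ContinuousLinearMap.rotation θ z).1 +
        Real.sin δ • (ContinuousLinearMap.rotation θ z).2 := by
  simp only [ContinuousLinearMap.rotation_apply, Real.cos_add, Real.sin_add]
  module

end Gaussian

/-! ### Exponential moments of norming functions under the Gaussian measure -/

section Gaussian

variable {E : Type*} [NormedAddCommGroup E] [InnerProductSpace ℝ E] [FiniteDimensional ℝ E]
  [MeasurableSpace E] [BorelSpace E]

theorem integrable_exp_mul_norm (t : ℝ) :
    Integrable (fun x : E => Real.exp (t * ‖x‖)) (stdGaussian E) := by
  obtain ⟨C, hC, h⟩ := IsGaussian.exists_integrable_exp_sq (stdGaussian E)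
  refine (h.const_mul (Real.exp (t ^ 2 / (4 * C)))).mono'
    (by fun_prop) (ae_of_all _ fun x => ?_)
  rw [Real.norm_of_nonneg (Real.exp_pos _).le, ← Real.exp_add]
  gcongr
  have : t ^ 2 / (4 * C) + C * ‖x‖ ^ 2 - t * ‖x‖ = (t - 2 * C * ‖x‖) ^ 2 / (4 * C) := by
    field_simp; ring
  have h2 : 0 ≤ (t - 2 * C * ‖x‖) ^ 2 / (4 * C) := by positivity
  linarith

theorem integral_exp_dual (L : StrongDual ℝ E) :
    ∫ x, Real.exp (L x) ∂(stdGaussian E) = Real.exp (‖L‖ ^ 2 / 2) := by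
  have h := IsGaussian.map_eq_gaussianReal (μ := stdGaussian E) L
  have h2 := mgf_gaussianReal h 1
  simp only [mgf, one_mul, integral_strongDual_stdGaussian, variance_dual_stdGaussian] at h2
  rw [h2]
  simp

theorem integrable_exp_of_le {F : E → ℝ} (hF : Continuous F) {t : ℝ} (h : ∀ x, F x ≤ t * ‖x‖) :
    Integrable (fun x => Real.exp (F x)) (stdGaussian E) := by
  refine (integrable_exp_mul_norm t).mono' (by fun_prop) (ae_of_all _ fun x => ?_)
  rw [Real.norm_of_nonneg (Real.exp_pos _).le]
  exact Real.exp_le_exp.2 (h x)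

theorem integrable_exp_of_le_add {F : E × E → ℝ} (hF : Continuous F) {t : ℝ}
    (h : ∀ z, F z ≤ t * ‖z.1‖ + t * ‖z.2‖) :
    Integrable (fun z => Real.exp (F z)) ((stdGaussian E).prod (stdGaussian E)) := by
  refine ((integrable_exp_mul_norm t).mul_prod (integrable_exp_mul_norm t)).mono'
    (by fun_prop) (ae_of_all _ fun x => ?_)
  rw [Real.norm_of_nonneg (Real.exp_pos _).le, ← Real.exp_add]
  exact Real.exp_le_exp.2 (h x)

/-- One small rotation, conditionally on the first variable. -/
theorem IsNorming.integral_exp_rotation_le {F : E → ℝ} (hF : IsNorming F) {μ c s : ℝ} (hμ : 0 ≤ μ)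
    (hc : c ≤ 1) (x : E) :
    ∫ y, Real.exp (μ * (F x - F (c • x + s • y))) ∂(stdGaussian E) ≤
      Real.exp ((μ * s) ^ 2 / 2) * Real.exp (μ * (1 - c) * ‖x‖) := by
  obtain ⟨g, hg, hle, hx⟩ := hF.2 x
  have hgx : g x ≤ ‖x‖ := (le_abs_self _).trans ((g.le_of_opNorm_le hg x).trans_eq (one_mul _))
  calc ∫ y, Real.exp (μ * (F x - F (c • x + s • y))) ∂(stdGaussian E)
      ≤ ∫ y, Real.exp (μ * (1 - c) * ‖x‖) * Real.exp ((-(μ * s) • g) y) ∂(stdGaussian E) := by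
        refine integral_mono_of_nonneg (ae_of_all _ fun y => (Real.exp_pos _).le) ?_
          (ae_of_all _ fun y => ?_)
        · refine (integrable_exp_of_le (t := ‖-(μ * s) • g‖) (by fun_prop) fun y => ?_).const_mul _
          exact (le_abs_self _).trans ((-(μ * s) • g).le_opNorm y)
        · simp only
          rw [← Real.exp_add]
          gcongr
          -- Bounding `F` below by the functional that norms `x` linearises the increment: for fixed
          -- `x` only the Gaussian variable `g y` remains random.
          have h1 := hle (c • x + s • y)
          simp only [map_add, map_smul, smul_eq_mul] at h1
          have h2 : F x - F (c • x + s • y) ≤ (1 - c) * ‖x‖ - s * g y := by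
            nlinarith [mul_le_mul_of_nonneg_left hgx (sub_nonneg.2 hc)]
          have h3 := mul_le_mul_of_nonneg_left h2 hμ
          simp only [smul_apply, smul_eq_mul]
          linarith
    _ = Real.exp (μ * (1 - c) * ‖x‖) * Real.exp (‖-(μ * s) • g‖ ^ 2 / 2) := by
        rw [integral_const_mul, integral_exp_dual]
    _ ≤ _ := by
        rw [mul_comm]
        have : ‖-(μ * s) • g‖ ^ 2 ≤ (μ * s) ^ 2 := by
          rw [norm_smul, mul_pow, Real.norm_eq_abs, sq_abs, neg_sq]
          exact mul_le_of_le_one_right (sq_nonneg _) (by nlinarith [norm_nonneg g])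
        gcongr

theorem IsNorming.integral_prod_exp_rotation_le {F : E → ℝ} (hF : IsNorming F) {μ c s : ℝ}
    (hμ : 0 ≤ μ) (hc : |c| ≤ 1) (hs : |s| ≤ 1) :
    Integrable (fun z : E × E => Real.exp (μ * (F z.1 - F (c • z.1 + s • z.2))))
      ((stdGaussian E).prod (stdGaussian E)) ∧
    ∫ z, Real.exp (μ * (F z.1 - F (c • z.1 + s • z.2))) ∂((stdGaussian E).prod (stdGaussian E)) ≤
      Real.exp ((μ * s) ^ 2 / 2) * ∫ x, Real.exp (μ * (1 - c) * ‖x‖) ∂(stdGaussian E) := by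
  have hFc := hF.1
  have hint : Integrable (fun z : E × E => Real.exp (μ * (F z.1 - F (c • z.1 + s • z.2))))
      ((stdGaussian E).prod (stdGaussian E)) := by
    refine integrable_exp_of_le_add (t := 2 * μ) (by fun_prop) fun z => ?_
    have h1 := (abs_le.1 (hF.abs_le_norm z.1)).2
    have h2 := (abs_le.1 (hF.abs_le_norm (c • z.1 + s • z.2))).1
    have h3 : ‖c • z.1 + s • z.2‖ ≤ ‖z.1‖ + ‖z.2‖ := by
      refine (norm_add_le _ _).trans ?_
      rw [norm_smul, norm_smul, Real.norm_eq_abs, Real.norm_eq_abs]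
      exact add_le_add (mul_le_of_le_one_left (norm_nonneg _) hc)
        (mul_le_of_le_one_left (norm_nonneg _) hs)
    have h4 : F z.1 - F (c • z.1 + s • z.2) ≤ 2 * ‖z.1‖ + 2 * ‖z.2‖ := by
      linarith [norm_nonneg z.2]
    linarith [mul_le_mul_of_nonneg_left h4 hμ]
  refine ⟨hint, ?_⟩
  rw [integral_prod _ hint, ← integral_const_mul]
  exact integral_mono_of_nonneg (ae_of_all _ fun x => integral_nonneg fun y => (Real.exp_pos _).le)
    ((integrable_exp_mul_norm _).const_mul _)
    (ae_of_all _ fun x => hF.integral_exp_rotation_le hμ (abs_le.1 hc).2 x)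

theorem integrable_integral_comp_rotation {K : E × E → ℝ}
    (hK : Integrable K ((stdGaussian E).prod (stdGaussian E))) (hm : Continuous K) (θ : ℝ) :
    Integrable (fun z => K (ContinuousLinearMap.rotation θ z))
      ((stdGaussian E).prod (stdGaussian E)) ∧
    ∫ z, K (ContinuousLinearMap.rotation θ z) ∂((stdGaussian E).prod (stdGaussian E)) =
      ∫ z, K z ∂((stdGaussian E).prod (stdGaussian E)) := by
  have hmap := IsGaussian.map_rotation_eq_self (μ := stdGaussian E) (by simp) θ
  have hmeas : Measurable (ContinuousLinearMap.rotation θ : E × E →L[ℝ] E × E) :=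
    (ContinuousLinearMap.rotation θ).continuous.measurable
  constructor
  · have : Integrable K (((stdGaussian E).prod (stdGaussian E)).map
        (ContinuousLinearMap.rotation θ)) := by rwa [hmap]
    exact this.comp_measurable hmeas
  · conv_rhs => rw [← hmap]
    rw [integral_map hmeas.aemeasurable hm.aestronglyMeasurable]

/-- The quarter turn from `z.1` to `z.2` is cut into N = n + 1 rotations by δ = π/(2N), and Jensen's
inequality is applied to the average of the N increments, each scaled by N. With μ = tN the variance
term is at most (tNδ)²/2 = t²π²/8 for every N, while the curvature term is at most tNδ²/2 =
tπ²/(8N), which vanishes as N grows. -/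
theorem IsNorming.integral_exp_sub_le_step {F : E → ℝ} (hF : IsNorming F) {t : ℝ} (ht : 0 ≤ t)
    (n : ℕ) :
    ∫ z, Real.exp (t * (F z.1 - F z.2)) ∂((stdGaussian E).prod (stdGaussian E)) ≤
      Real.exp (t ^ 2 * Real.pi ^ 2 / 8) *
        ∫ x, Real.exp (t * Real.pi ^ 2 / (8 * (n + 1)) * ‖x‖) ∂(stdGaussian E) := by
  set N : ℝ := n + 1 with hN
  have hN0 : 0 < N := by positivity
  set δ : ℝ := Real.pi / (2 * N) with hδ
  have hδ0 : 0 ≤ δ := by positivity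
  have hFc := hF.1
  set K : E × E → ℝ := fun z => Real.exp (t * N * (F z.1 - F (Real.cos δ • z.1 + Real.sin δ • z.2)))
    with hK
  have hKc : Continuous K := by fun_prop
  obtain ⟨hint, hle⟩ := hF.integral_prod_exp_rotation_le (μ := t * N) (by positivity)
    (Real.abs_cos_le_one δ) (Real.abs_sin_le_one δ)
  have hpt : ∀ z : E × E, Real.exp (t * (F z.1 - F z.2)) ≤
      ∑ i ∈ Finset.range (n + 1), N⁻¹ * K (ContinuousLinearMap.rotation (i * δ) z) := by
    intro z
    set Z : ℕ → ℝ := fun i => F (ContinuousLinearMap.rotation (i * δ) z).1 with hZ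
    have h0 : F z.1 = Z 0 := by simp [hZ, ContinuousLinearMap.rotation_apply]
    have h1 : F z.2 = Z (n + 1) := by
      have : ((n + 1 : ℕ) : ℝ) * δ = Real.pi / 2 := by
        rw [hδ]; push_cast; rw [← hN]; field_simp
      simp only [hZ]
      rw [this]
      simp [ContinuousLinearMap.rotation_apply]
    have h2 : ∀ i : ℕ, K (ContinuousLinearMap.rotation (i * δ) z) =
        Real.exp (t * N * (Z i - Z (i + 1))) := by
      intro i
      simp only [hK, hZ]
      rw [← rotation_step]
      push_cast
      rw [add_mul, one_mul]
    have h3 : t * (F z.1 - F z.2) =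
        ∑ i ∈ Finset.range (n + 1), N⁻¹ • (t * N * (Z i - Z (i + 1))) := by
      rw [h0, h1, ← Finset.sum_range_sub', Finset.mul_sum]
      refine Finset.sum_congr rfl fun i _ => ?_
      simp only [smul_eq_mul]
      field_simp
    rw [h3]
    refine (convexOn_exp.map_sum_le (fun i _ => by positivity) ?_ fun i _ => Set.mem_univ _).trans_eq
      (Finset.sum_congr rfl fun i _ => by rw [h2, smul_eq_mul])
    rw [Finset.sum_const, Finset.card_range, nsmul_eq_mul]
    push_cast
    rw [← hN, mul_inv_cancel₀ hN0.ne']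
  calc _ ≤ ∫ z, ∑ i ∈ Finset.range (n + 1), N⁻¹ * K (ContinuousLinearMap.rotation (i * δ) z)
        ∂((stdGaussian E).prod (stdGaussian E)) :=
        integral_mono_of_nonneg (ae_of_all _ fun z => (Real.exp_pos _).le)
          (integrable_finsetSum _ fun i _ =>
            (integrable_integral_comp_rotation hint hKc _).1.const_mul _) (ae_of_all _ hpt)
    _ = ∫ z, K z ∂((stdGaussian E).prod (stdGaussian E)) := by
        rw [integral_finsetSum _ fun i _ =>
            (integrable_integral_comp_rotation hint hKc _).1.const_mul _]
        simp_rw [integral_const_mul, (integrable_integral_comp_rotation hint hKc _).2]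
        rw [Finset.sum_const, Finset.card_range, nsmul_eq_mul]
        push_cast
        rw [← hN, mul_inv_cancel_left₀ hN0.ne']
    _ ≤ _ := hle
    _ ≤ _ := by
        have hsin : |Real.sin δ| ≤ δ := by
          simpa [abs_of_nonneg hδ0] using Real.abs_sin_le_abs (x := δ)
        have hcos : 1 - Real.cos δ ≤ δ ^ 2 / 2 := by
          linarith [Real.one_sub_sq_div_two_le_cos (x := δ)]
        refine mul_le_mul ?_ ?_ (integral_nonneg fun x => (Real.exp_pos _).le) (Real.exp_pos _).le
        · have : (t * N * Real.sin δ) ^ 2 ≤ (t * N * δ) ^ 2 := by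
            rw [mul_pow, mul_pow (t * N)]
            exact mul_le_mul_of_nonneg_left (sq_le_sq' (abs_le.1 hsin).1 (abs_le.1 hsin).2)
              (sq_nonneg _)
          have h2 : t * N * δ = t * Real.pi / 2 := by rw [hδ]; field_simp
          rw [h2] at this
          exact Real.exp_le_exp.2 (by linarith)
        · refine integral_mono (integrable_exp_mul_norm _) (integrable_exp_mul_norm _) fun x => ?_
          simp only
          gcongr
          calc t * N * (1 - Real.cos δ) ≤ t * N * (δ ^ 2 / 2) := by gcongr
            _ = _ := by rw [hδ]; field_simp; ring

/-- **Gaussian concentration** in the form of Maurey and Pisier. -/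
theorem IsNorming.integral_exp_sub_le {F : E → ℝ} (hF : IsNorming F) {t : ℝ} (ht : 0 ≤ t) :
    ∫ z, Real.exp (t * (F z.1 - F z.2)) ∂((stdGaussian E).prod (stdGaussian E)) ≤
      Real.exp (t ^ 2 * Real.pi ^ 2 / 8) := by
  -- As the subdivision is refined, the curvature factor tends to 1 by dominated convergence.
  have hlim : Tendsto (fun n : ℕ => ∫ x, Real.exp (t * Real.pi ^ 2 / (8 * (n + 1)) * ‖x‖)
      ∂(stdGaussian E)) atTop (𝓝 (∫ x, 1 ∂(stdGaussian E))) := by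
    refine tendsto_integral_of_dominated_convergence
      (fun x => Real.exp (t * Real.pi ^ 2 / 8 * ‖x‖)) (fun n => by fun_prop)
      (integrable_exp_mul_norm _) (fun n => ae_of_all _ fun x => ?_) (ae_of_all _ fun x => ?_)
    · rw [Real.norm_of_nonneg (Real.exp_pos _).le]
      gcongr
      linarith [(Nat.cast_nonneg n : (0 : ℝ) ≤ n)]
    · have h1 : Tendsto (fun n : ℕ => t * Real.pi ^ 2 / 8 * (1 / ((n : ℝ) + 1)) * ‖x‖) atTop
          (𝓝 (t * Real.pi ^ 2 / 8 * 0 * ‖x‖)) :=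
        (tendsto_one_div_add_atTop_nhds_zero_nat.const_mul _).mul_const _
      have h2 := (Real.continuous_exp.tendsto _).comp h1
      simp only [mul_zero, zero_mul, Real.exp_zero] at h2
      refine h2.congr fun n => ?_
      simp only [Function.comp]
      congr 2
      field_simp
  have h := ge_of_tendsto (hlim.const_mul (Real.exp (t ^ 2 * Real.pi ^ 2 / 8)))
    (Eventually.of_forall fun n => hF.integral_exp_sub_le_step ht n)
  simpa using h

theorem IsNorming.integrable {F : E → ℝ} (hF : IsNorming F) : Integrable F (stdGaussian E) := by
  have hFc := hF.1
  refine (IsGaussian.integrable_id (μ := stdGaussian E)).norm.mono'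
    hFc.aestronglyMeasurable (ae_of_all _ fun x => hF.abs_le_norm x)

theorem IsNorming.integrable_exp {F : E → ℝ} (hF : IsNorming F) (t a : ℝ) :
    Integrable (fun x => Real.exp (t * (F x - a))) (stdGaussian E) := by
  have hFc := hF.1
  have : ∀ x, Real.exp (t * (F x - a)) = Real.exp (-(t * a)) * Real.exp (t * F x) := fun x => by
    rw [← Real.exp_add]; ring_nf
  simp_rw [this]
  refine (integrable_exp_of_le (t := |t|) (by fun_prop) fun x => ?_).const_mul _
  refine (le_abs_self _).trans ?_
  rw [abs_mul]
  exact mul_le_mul_of_nonneg_left (hF.abs_le_norm x) (abs_nonneg _)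

theorem one_le_integral_exp {F : E → ℝ} (hF : IsNorming F) (t : ℝ) :
    1 ≤ ∫ x, Real.exp (t * (F x - ∫ y, F y ∂(stdGaussian E))) ∂(stdGaussian E) := by
  set a := ∫ y, F y ∂(stdGaussian E) with ha
  have hi : Integrable (fun x => t * (F x - a)) (stdGaussian E) :=
    (hF.integrable.sub (integrable_const a)).const_mul t
  calc (1 : ℝ) = ∫ x, (t * (F x - a) + 1) ∂(stdGaussian E) := by
        rw [integral_add hi (integrable_const _), integral_const_mul,
          integral_sub hF.integrable (integrable_const _), ← ha]
        simp
    _ ≤ _ := integral_mono (hi.add (integrable_const _)) (hF.integrable_exp t a)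
        fun x => Real.add_one_le_exp _

/-- By independence the moment of `F z.1 - F z.2` splits into the centred moments at `t` and `-t`.
Each is at least 1 by Jensen, so either one can be dropped. -/
theorem IsNorming.integral_exp_le {F : E → ℝ} (hF : IsNorming F) (t : ℝ) :
    ∫ x, Real.exp (t * (F x - ∫ y, F y ∂(stdGaussian E))) ∂(stdGaussian E) ≤
      Real.exp (t ^ 2 * Real.pi ^ 2 / 8) := by
  wlog ht : 0 ≤ t generalizing
  all_goals set a := ∫ y, F y ∂(stdGaussian E) with ha
  all_goals
    have key : ∀ s : ℝ, ∫ z, Real.exp (s * (F z.1 - F z.2))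
        ∂((stdGaussian E).prod (stdGaussian E)) =
        (∫ x, Real.exp (s * (F x - a)) ∂(stdGaussian E)) *
          ∫ x, Real.exp (-s * (F x - a)) ∂(stdGaussian E) := by
      intro s
      rw [← integral_prod_mul]
      refine integral_congr_ae (ae_of_all _ fun z => ?_)
      simp only
      rw [← Real.exp_add]
      ring_nf
  · have h1 := hF.integral_exp_sub_le (t := -t) (by linarith)
    rw [key, neg_neg, neg_sq] at h1
    exact (le_mul_of_one_le_left (integral_nonneg fun x => (Real.exp_pos _).le)
      (one_le_integral_exp hF _)).trans h1
  · have h1 := hF.integral_exp_sub_le ht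
    rw [key] at h1
    exact (le_mul_of_one_le_right (integral_nonneg fun x => (Real.exp_pos _).le)
      (one_le_integral_exp hF _)).trans h1

end Gaussian

/-! ### Gaussian measure of a cone, and the mean of the norm -/

section GaussianCone

variable {E : Type*} [NormedAddCommGroup E] [InnerProductSpace ℝ E] [FiniteDimensional ℝ E]
  [MeasurableSpace E] [BorelSpace E]

/-- A Chernoff bound: in the cone either `F` lies below its mean or the norm lies above its own. The
two deviations are dependent, so their exponentials are separated by uv ≤ (u² + v²)/2, which doubles
the parameter. -/
theorem IsNorming.measureReal_cone_le {F : E → ℝ} (hF : IsNorming F) {ε c : ℝ} (hε : 0 ≤ ε)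
    (hc : 0 ≤ c) (hc1 : c ≤ 1)
    (hm : (c + ε) * ∫ x, ‖x‖ ∂(stdGaussian E) ≤ ∫ x, F x ∂(stdGaussian E)) :
    (stdGaussian E).real {x | F x ≤ c * ‖x‖} ≤
      Real.exp (-(ε * ∫ x, ‖x‖ ∂(stdGaussian E)) ^ 2 / (2 * Real.pi ^ 2)) := by
  have hN : IsNorming (fun x : E => ‖x‖) := isNorming_norm
  have hFc := hF.1
  set b := ∫ x : E, ‖x‖ ∂(stdGaussian E) with hb
  set a := ∫ x, F x ∂(stdGaussian E) with ha
  have hb0 : 0 ≤ b := integral_nonneg fun x => norm_nonneg x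
  -- This value minimises the resulting exponent t²π²/2 - tεb.
  set t := ε * b / Real.pi ^ 2 with ht
  have ht0 : 0 ≤ t := by positivity
  set H : E → ℝ := fun x => (Real.exp (-(2 * t) * (F x - a)) +
    Real.exp (2 * t * c * (‖x‖ - b))) * (Real.exp (-(t * (ε * b))) / 2) with hH
  have hi1 := hF.integrable_exp (-(2 * t)) a
  have hi2 := hN.integrable_exp (2 * t * c) b
  have hHi : Integrable H (stdGaussian E) := (hi1.add hi2).mul_const _
  have hset : MeasurableSet {x : E | F x ≤ c * ‖x‖} :=
    (isClosed_le hFc (by fun_prop)).measurableSet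
  have h1 : (stdGaussian E).real {x | F x ≤ c * ‖x‖} ≤ ∫ x, H x ∂(stdGaussian E) := by
    rw [← integral_indicator_one hset]
    refine integral_mono ((integrable_indicator_iff hset).2 (integrable_const _).integrableOn)
      hHi fun x => ?_
    refine Set.indicator_le' (fun x hx => ?_) (fun x _ => by positivity) x
    simp only [Pi.one_apply]
    set u := -t * (F x - a) with hu
    set v := t * c * (‖x‖ - b) with hv
    have h0 : 0 ≤ u + v + -(t * (ε * b)) := by
      have e1 := mul_nonneg ht0 (sub_nonneg.2 hx)
      have e2 := mul_nonneg ht0 (sub_nonneg.2 hm)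
      rw [hu, hv]
      linarith
    calc (1 : ℝ) ≤ Real.exp (u + v + -(t * (ε * b))) := Real.one_le_exp h0
      _ = Real.exp u * Real.exp v * Real.exp (-(t * (ε * b))) := by
          rw [Real.exp_add, Real.exp_add]
      _ ≤ ((Real.exp u ^ 2 + Real.exp v ^ 2) / 2) * Real.exp (-(t * (ε * b))) := by
          gcongr
          nlinarith [sq_nonneg (Real.exp u - Real.exp v)]
      _ = H x := by
          simp only [hH]
          rw [← Real.exp_nat_mul, ← Real.exp_nat_mul, hu, hv]
          push_cast
          ring_nf
  refine h1.trans ?_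
  have h2 : ∫ x, H x ∂(stdGaussian E) = (∫ x, Real.exp (-(2 * t) * (F x - a)) ∂(stdGaussian E) +
      ∫ x, Real.exp (2 * t * c * (‖x‖ - b)) ∂(stdGaussian E)) *
        (Real.exp (-(t * (ε * b))) / 2) := by
    rw [integral_mul_const, integral_add hi1 hi2]
  have h3 := hF.integral_exp_le (-(2 * t))
  have h4 := hN.integral_exp_le (2 * t * c)
  have h5 : Real.exp ((2 * t * c) ^ 2 * Real.pi ^ 2 / 8) ≤
      Real.exp ((-(2 * t)) ^ 2 * Real.pi ^ 2 / 8) := by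
    gcongr 1
    have : c ^ 2 ≤ 1 := by nlinarith
    have h6 : (2 * t * c) ^ 2 ≤ (-(2 * t)) ^ 2 := by
      rw [mul_pow, neg_sq]
      exact mul_le_of_le_one_right (sq_nonneg _) this
    gcongr
  rw [h2]
  calc _ ≤ (Real.exp ((-(2 * t)) ^ 2 * Real.pi ^ 2 / 8) +
        Real.exp ((-(2 * t)) ^ 2 * Real.pi ^ 2 / 8)) * (Real.exp (-(t * (ε * b))) / 2) := by
        gcongr
        exact h4.trans h5
    _ = Real.exp ((-(2 * t)) ^ 2 * Real.pi ^ 2 / 8 + -(t * (ε * b))) := by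
        rw [Real.exp_add]; ring
    _ = _ := by
        congr 1
        rw [ht]
        field_simp
        ring

theorem integrable_norm_sq_stdGaussian :
    Integrable (fun x : E => ‖x‖ ^ 2) (stdGaussian E) :=
  (IsGaussian.memLp_two_id (μ := stdGaussian E)).integrable_norm_pow (by norm_num)

theorem integral_norm_sq_stdGaussian :
    ∫ x : E, ‖x‖ ^ 2 ∂(stdGaussian E) = Module.finrank ℝ E := by
  set v := stdOrthonormalBasis ℝ E with hv
  have hsq : ∀ x : E, ‖x‖ ^ 2 = ∑ i, (innerSL ℝ (v i) x) ^ 2 := fun x => by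
    simpa using (v.sum_sq_inner_right x).symm
  have hL : ∀ L : StrongDual ℝ E, MemLp L 2 (stdGaussian E) := fun L =>
    L.comp_memLp' IsGaussian.memLp_two_id
  simp_rw [hsq]
  rw [integral_finsetSum _ fun i _ => (hL _).integrable_sq]
  have : ∀ i, ∫ x, (innerSL ℝ (v i) x) ^ 2 ∂(stdGaussian E) = 1 := fun i => by
    have h1 := variance_dual_stdGaussian (innerSL ℝ (v i))
    rw [variance_eq_sub (hL _), integral_strongDual_stdGaussian] at h1
    simpa using h1
  rw [Finset.sum_congr rfl fun i _ => this i]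
  simp

/-- The right side is 4 sinh²(x/2). -/
theorem sq_le_exp_add_exp_neg_sub_two (x : ℝ) : x ^ 2 ≤ Real.exp x + Real.exp (-x) - 2 := by
  have h1 : |x / 2| ≤ Real.sinh |x / 2| := Real.self_le_sinh_iff.2 (abs_nonneg _)
  have h2 : |x / 2| ^ 2 ≤ Real.sinh |x / 2| ^ 2 := by gcongr
  have h3 := Real.cosh_two_mul |x / 2|
  have h4 : 2 * |x / 2| = |x| := by rw [abs_div, abs_two]; ring
  rw [h4, Real.cosh_sq, Real.cosh_abs, Real.cosh_eq] at h3
  rw [sq_abs] at h2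
  linarith

/-- The left side minus the right is Var ‖x‖ - 5. The variance is controlled by the exponential
moments at ±1, each at most exp(π²/8) ≤ 7/2, and 7/2 + 7/2 - 2 = 5. -/
theorem finrank_sub_five_le :
    (Module.finrank ℝ E : ℝ) - 5 ≤ (∫ x : E, ‖x‖ ∂(stdGaussian E)) ^ 2 := by
  have hN : IsNorming (fun x : E => ‖x‖) := isNorming_norm
  have h1 := hN.integral_exp_le 1
  have h2 := hN.integral_exp_le (-1)
  have hi1 := hN.integrable_exp 1 (∫ x : E, ‖x‖ ∂(stdGaussian E))
  have hi2 := hN.integrable_exp (-1) (∫ x : E, ‖x‖ ∂(stdGaussian E))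
  have hi := hN.integrable
  set b := ∫ x : E, ‖x‖ ∂(stdGaussian E) with hb
  have hvar : ∫ x : E, (‖x‖ - b) ^ 2 ∂(stdGaussian E) = Module.finrank ℝ E - b ^ 2 := by
    have : ∀ x : E, (‖x‖ - b) ^ 2 = ‖x‖ ^ 2 - (2 * b * ‖x‖ - b ^ 2) := fun x => by ring
    simp_rw [this]
    have hj : Integrable (fun x : E => 2 * b * ‖x‖ - b ^ 2) (stdGaussian E) :=
      (hi.const_mul _).sub (integrable_const _)
    rw [integral_sub integrable_norm_sq_stdGaussian hj, integral_sub (hi.const_mul _)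
      (integrable_const _), integral_const_mul, ← hb, integral_norm_sq_stdGaussian]
    simp
    ring
  have hle : ∫ x : E, (‖x‖ - b) ^ 2 ∂(stdGaussian E) ≤
      ∫ x : E, (Real.exp (1 * (‖x‖ - b)) + Real.exp (-1 * (‖x‖ - b)) - 2) ∂(stdGaussian E) := by
    refine integral_mono_of_nonneg (ae_of_all _ fun x => sq_nonneg _)
      ((hi1.add hi2).sub (integrable_const _)) (ae_of_all _ fun x => ?_)
    simp only [one_mul, neg_one_mul]
    exact sq_le_exp_add_exp_neg_sub_two _
  have hj : Integrable (fun x : E => Real.exp (1 * (‖x‖ - b)) + Real.exp (-1 * (‖x‖ - b)))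
    (stdGaussian E) := hi1.add hi2
  rw [integral_sub hj (integrable_const _), integral_add hi1 hi2, hvar] at hle
  have hpi : Real.exp (Real.pi ^ 2 / 8) ≤ 7 / 2 := by
    have hp : Real.pi ^ 2 / 8 ≤ 5 / 4 := by
      nlinarith [Real.pi_lt_d2, Real.pi_pos]
    refine (Real.exp_le_exp.2 hp).trans ?_
    have h5 : Real.exp (5 / 4) ^ 4 = Real.exp 1 ^ 5 := by
      rw [← Real.exp_nat_mul, ← Real.exp_nat_mul]; norm_num
    have h6 : Real.exp 1 ^ 5 ≤ 2.7182818286 ^ 5 := by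
      gcongr
      exact Real.exp_one_lt_d9.le
    refine le_of_pow_le_pow_left₀ (n := 4) (by norm_num) (by norm_num) ?_
    rw [h5]
    refine h6.trans (by norm_num)
  simp only [one_pow, one_mul, neg_sq] at h1 h2 hle
  simp at hle
  simp at h2
  linarith

end GaussianCone

/-! ### Haar measure on the unitary group -/

section Haar

variable {E : Type*} [NormedAddCommGroup E] [InnerProductSpace ℂ E] [FiniteDimensional ℂ E]

instance compactSpace_unitary : CompactSpace (unitary (E →L[ℂ] E)) := by
  have : ProperSpace (E →L[ℂ] E) := FiniteDimensional.proper ℂ _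
  refine isCompact_iff_compactSpace.1
    (?_ : IsCompact (unitary (E →L[ℂ] E) : Set (E →L[ℂ] E)))
  refine Metric.isCompact_of_isClosed_isBounded ?_ ?_
  · have h : (unitary (E →L[ℂ] E) : Set (E →L[ℂ] E)) = {u | star u * u = 1} ∩ {u | u * star u = 1} :=
      Set.ext fun u => Unitary.mem_iff
    rw [h]
    exact (isClosed_eq (by fun_prop) continuous_const).inter
      (isClosed_eq (by fun_prop) continuous_const)
  · refine Metric.isBounded_closedBall (x := 0) (r := 1) |>.subset fun u hu => ?_
    rw [mem_closedBall_zero_iff]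
    refine u.opNorm_le_bound zero_le_one fun x => ?_
    rw [one_mul]
    exact (Unitary.norm_map ⟨u, hu⟩ x).le

variable (E) in
/-- The Haar probability measure on the unitary group of `E`. -/
noncomputable def haarUnitary : Measure (unitary (E →L[ℂ] E)) :=
  Measure.haarMeasure ⊤

instance isHaarMeasure_haarUnitary : (haarUnitary E).IsHaarMeasure := by
  unfold haarUnitary; infer_instance

instance isProbabilityMeasure_haarUnitary : IsProbabilityMeasure (haarUnitary E) := by
  refine ⟨?_⟩
  have h := Measure.haarMeasure_self
    (K₀ := (⊤ : TopologicalSpace.PositiveCompacts (unitary (E →L[ℂ] E))))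
  simpa [haarUnitary] using h

instance isMulRightInvariant_haarUnitary : (haarUnitary E).IsMulRightInvariant := by
  refine ⟨fun g => ?_⟩
  have : IsProbabilityMeasure ((haarUnitary E).map (· * g)) :=
    Measure.isProbabilityMeasure_map (by fun_prop)
  exact Measure.isHaarMeasure_eq_of_isProbabilityMeasure _ _

/-- The isometry of the line through `u` that sends `u` to `v` extends to the whole space. With
right invariance this makes the law of U e the same for all unit vectors e. -/
theorem exists_unitary_apply_eq {u v : E} (hu : ‖u‖ = 1) (hv : ‖v‖ = 1) :
    ∃ W : unitary (E →L[ℂ] E), (W : E →L[ℂ] E) u = v := by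
  let L : (ℂ ∙ u) →ₗᵢ[ℂ] E := (LinearIsometry.toSpanSingleton ℂ E hv).comp
    (LinearIsometryEquiv.toSpanUnitSingleton u hu).symm.toLinearIsometry
  let e : E ≃ₗᵢ[ℂ] E := L.extend.toLinearIsometryEquiv rfl
  refine ⟨Unitary.linearIsometryEquiv.symm e, ?_⟩
  have hmem : u ∈ (ℂ ∙ u) := Submodule.mem_span_singleton_self u
  have h1 : L.extend u = L ⟨u, hmem⟩ := L.extend_apply ⟨u, hmem⟩
  have h2 : (LinearIsometryEquiv.toSpanUnitSingleton u hu).symm ⟨u, hmem⟩ = (1 : ℂ) := by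
    rw [LinearIsometryEquiv.symm_apply_eq]
    simp
  change L.extend u = v
  rw [h1]
  change LinearIsometry.toSpanSingleton ℂ E hv
    ((LinearIsometryEquiv.toSpanUnitSingleton u hu).symm ⟨u, hmem⟩) = v
  rw [h2]
  simp

theorem integral_haarUnitary_apply_eq (h : E → ℝ) {u v : E} (hu : ‖u‖ = 1) (hv : ‖v‖ = 1) :
    ∫ U, h ((U : E →L[ℂ] E) u) ∂(haarUnitary E) = ∫ U, h ((U : E →L[ℂ] E) v) ∂(haarUnitary E) := by
  obtain ⟨W, hW⟩ := exists_unitary_apply_eq hu hv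
  rw [← integral_mul_right_eq_self (fun U : unitary (E →L[ℂ] E) => h ((U : E →L[ℂ] E) u)) W]
  refine integral_congr_ae (ae_of_all _ fun U => ?_)
  simp [hW]

theorem haarUnitary_apply_mem_eq (C : Set E) {u v : E} (hu : ‖u‖ = 1)
    (hv : ‖v‖ = 1) :
    haarUnitary E {U | (U : E →L[ℂ] E) u ∈ C} = haarUnitary E {U | (U : E →L[ℂ] E) v ∈ C} := by
  obtain ⟨W, hW⟩ := exists_unitary_apply_eq hu hv
  rw [← measure_preimage_mul_right (haarUnitary E) W]
  simp [Set.preimage, hW]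

theorem integral_haarUnitary_left (h : E → ℝ) (u : E) (W : unitary (E →L[ℂ] E)) :
    ∫ U, h ((W : E →L[ℂ] E) ((U : E →L[ℂ] E) u)) ∂(haarUnitary E) =
      ∫ U, h ((U : E →L[ℂ] E) u) ∂(haarUnitary E) :=
  integral_mul_left_eq_self (fun U : unitary (E →L[ℂ] E) => h ((U : E →L[ℂ] E) u)) W

theorem integrable_haarUnitary {h : unitary (E →L[ℂ] E) → ℝ} (hh : Continuous h) :
    Integrable h (haarUnitary E) :=
  hh.integrable_of_hasCompactSupport (HasCompactSupport.of_compactSpace h)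

/-! ### Fourth moments -/

theorem integral_norm_inner_pow_four_eq (e : E) {u v : E} (hu : ‖u‖ = 1) (hv : ‖v‖ = 1) :
    ∫ U, ‖inner ℂ u ((U : E →L[ℂ] E) e)‖ ^ 4 ∂(haarUnitary E) =
      ∫ U, ‖inner ℂ v ((U : E →L[ℂ] E) e)‖ ^ 4 ∂(haarUnitary E) := by
  obtain ⟨W, hW⟩ := exists_unitary_apply_eq hu hv
  rw [← integral_haarUnitary_left (fun x => ‖inner ℂ v x‖ ^ 4) e W]
  simp_rw [← hW, Unitary.inner_map_map]

/-- Averaging over four phases of `b` cancels every phase-dependent term and isolates the mixed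
moment |a|²|b|². -/
theorem sum_norm_pow_four_phases (a b : ℂ) :
    ‖a + b‖ ^ 4 + ‖a - b‖ ^ 4 + ‖a + Complex.I * b‖ ^ 4 + ‖a - Complex.I * b‖ ^ 4 =
      4 * ‖a‖ ^ 4 + 4 * ‖b‖ ^ 4 + 16 * (‖a‖ ^ 2 * ‖b‖ ^ 2) := by
  have h : ∀ z : ℂ, ‖z‖ ^ 4 = (z.re * z.re + z.im * z.im) ^ 2 := fun z => by
    rw [← Complex.normSq_apply, Complex.normSq_eq_norm_sq]; ring
  have h2 : ∀ z : ℂ, ‖z‖ ^ 2 = (z.re * z.re + z.im * z.im) := fun z => by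
    rw [← Complex.normSq_apply, Complex.normSq_eq_norm_sq]
  simp only [h, h2, Complex.add_re, Complex.add_im, Complex.sub_re, Complex.sub_im, Complex.mul_re,
    Complex.mul_im, Complex.I_re, Complex.I_im]
  ring

/-- Each of the four vectors u + zv has norm √2 and hence fourth moment 4A. The phase identity
integrates to 16A = 8A + 16X, so the mixed moment X is A/2. -/
theorem integral_norm_inner_sq_mul_sq (e : E) {u v : E} (hu : ‖u‖ = 1) (hv : ‖v‖ = 1)
    (huv : inner ℂ u v = 0) :
    ∫ U, ‖inner ℂ u ((U : E →L[ℂ] E) e)‖ ^ 2 * ‖inner ℂ v ((U : E →L[ℂ] E) e)‖ ^ 2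
      ∂(haarUnitary E) =
      (∫ U, ‖inner ℂ u ((U : E →L[ℂ] E) e)‖ ^ 4 ∂(haarUnitary E)) / 2 := by
  set A := ∫ U, ‖inner ℂ u ((U : E →L[ℂ] E) e)‖ ^ 4 ∂(haarUnitary E) with hA
  have key : ∀ z : ℂ, ‖z‖ = 1 →
      ∫ U, ‖inner ℂ u ((U : E →L[ℂ] E) e) + conj z * inner ℂ v ((U : E →L[ℂ] E) e)‖ ^ 4
        ∂(haarUnitary E) = 4 * A := by
    intro z hz
    have hn : ‖u + z • v‖ ^ 2 = 2 := by
      have h0 : inner ℂ u (z • v) = 0 := by rw [inner_smul_right, huv, mul_zero]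
      have := norm_add_sq_eq_norm_sq_add_norm_sq_of_inner_eq_zero u (z • v) h0
      rw [norm_smul, hz, hu, hv] at this
      rw [sq, this]; norm_num
    set r : ℝ := ‖u + z • v‖ with hr
    have hr0 : 0 < r := by
      refine lt_of_le_of_ne (norm_nonneg _) fun h => ?_
      rw [← h] at hn; norm_num at hn
    have hw : ‖((r⁻¹ : ℝ) : ℂ) • (u + z • v)‖ = 1 := by
      rw [norm_smul, Complex.norm_real, ← hr, Real.norm_of_nonneg (by positivity),
        inv_mul_cancel₀ hr0.ne']
    have h1 := integral_norm_inner_pow_four_eq e hw hu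
    have h2 : ∀ x : E, ‖inner ℂ (((r⁻¹ : ℝ) : ℂ) • (u + z • v)) x‖ ^ 4 =
        (1 / 4) * ‖inner ℂ u x + conj z * inner ℂ v x‖ ^ 4 := fun x => by
      rw [inner_smul_left, inner_add_left, inner_smul_left, norm_mul, mul_pow, Complex.conj_ofReal,
        Complex.norm_real, Real.norm_of_nonneg (by positivity), inv_pow]
      have : r ^ 4 = 4 := by rw [show r ^ 4 = (r ^ 2) ^ 2 by ring, hn]; norm_num
      rw [this]; norm_num
    simp_rw [h2] at h1
    rw [integral_const_mul, ← hA] at h1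
    linarith
  have k1 := key 1 (by simp)
  have k2 := key (-1) (by simp)
  have k3 := key Complex.I (by simp)
  have k4 := key (-Complex.I) (by simp)
  set f : ℂ → unitary (E →L[ℂ] E) → ℝ := fun z U =>
    ‖inner ℂ u ((U : E →L[ℂ] E) e) + conj z * inner ℂ v ((U : E →L[ℂ] E) e)‖ ^ 4 with hf
  set q : E → unitary (E →L[ℂ] E) → ℝ := fun w U => ‖inner ℂ w ((U : E →L[ℂ] E) e)‖ ^ 4 with hq
  have hi : ∀ z, Integrable (f z) (haarUnitary E) := fun z => integrable_haarUnitary (by fun_prop)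
  have hi4 : ∀ w, Integrable (fun U => 4 * q w U) (haarUnitary E) :=
    fun w => integrable_haarUnitary (by fun_prop)
  have h12 : Integrable (fun U => f 1 U + f (-1) U) (haarUnitary E) := (hi _).add (hi _)
  have h34 : Integrable (fun U => f Complex.I U + f (-Complex.I) U) (haarUnitary E) :=
    (hi _).add (hi _)
  have h1234 : Integrable (fun U => f 1 U + f (-1) U + (f Complex.I U + f (-Complex.I) U))
    (haarUnitary E) := h12.add h34
  have huv4 : Integrable (fun U => 4 * q u U + 4 * q v U) (haarUnitary E) := (hi4 u).add (hi4 v)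
  have hpt : ∀ U : unitary (E →L[ℂ] E),
      ‖inner ℂ u ((U : E →L[ℂ] E) e)‖ ^ 2 * ‖inner ℂ v ((U : E →L[ℂ] E) e)‖ ^ 2 =
      16⁻¹ * (f 1 U + f (-1) U + (f Complex.I U + f (-Complex.I) U) -
        (4 * q u U + 4 * q v U)) := by
    intro U
    have := sum_norm_pow_four_phases (inner ℂ u ((U : E →L[ℂ] E) e)) (inner ℂ v ((U : E →L[ℂ] E) e))
    simp only [hf, hq, map_neg, map_one, Complex.conj_I, one_mul, neg_mul, neg_neg,
      ← sub_eq_add_neg]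
    linarith
  have hqv : ∫ U, q v U ∂(haarUnitary E) = A := integral_norm_inner_pow_four_eq e hv hu
  simp_rw [hpt]
  rw [integral_const_mul, integral_sub h1234 huv4, integral_add h12 h34, integral_add (hi _) (hi _),
    integral_add (hi _) (hi _), integral_add (hi4 u) (hi4 v), integral_const_mul,
    integral_const_mul, hqv, k1, k2, k3, k4, ← hA]
  ring

/-- The moments are known up to the common factor `A`, which the case c = 1 determines: there the
sum is ‖U e‖² = 1. -/
theorem integral_sum_mul_norm_inner_sq_sq {ι : Type*} [Fintype ι] [Nonempty ι]
    (v : OrthonormalBasis ι ℂ E) {e : E} (he : ‖e‖ = 1) (c : ι → ℝ) :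
    ∫ U, (∑ i, c i * ‖inner ℂ (v i) ((U : E →L[ℂ] E) e)‖ ^ 2) ^ 2 ∂(haarUnitary E) =
      (∑ i, c i ^ 2 + (∑ i, c i) ^ 2) / (Fintype.card ι * (Fintype.card ι + 1)) := by
  classical
  obtain ⟨i₀⟩ := ‹Nonempty ι›
  set A := ∫ U, ‖inner ℂ (v i₀) ((U : E →L[ℂ] E) e)‖ ^ 4 ∂(haarUnitary E) with hA
  have hv : ∀ i, ‖v i‖ = 1 := fun i => v.orthonormal.1 i
  have hprod : ∀ i j, ∫ U, ‖inner ℂ (v i) ((U : E →L[ℂ] E) e)‖ ^ 2 *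
      ‖inner ℂ (v j) ((U : E →L[ℂ] E) e)‖ ^ 2 ∂(haarUnitary E) =
      A / 2 * (1 + if i = j then 1 else 0) := by
    intro i j
    have hAi := integral_norm_inner_pow_four_eq e (hv i) (hv i₀)
    split_ifs with hij
    · subst hij
      simp_rw [← pow_add]
      rw [hAi, ← hA]; ring
    · rw [integral_norm_inner_sq_mul_sq e (hv i) (hv j) (v.orthonormal.2 hij), hAi, ← hA]; ring
  have hgen : ∀ c : ι → ℝ, ∫ U, (∑ i, c i * ‖inner ℂ (v i) ((U : E →L[ℂ] E) e)‖ ^ 2) ^ 2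
      ∂(haarUnitary E) = A / 2 * (∑ i, c i ^ 2 + (∑ i, c i) ^ 2) := by
    intro c
    have hpt : ∀ x : E, (∑ i, c i * ‖inner ℂ (v i) x‖ ^ 2) ^ 2 =
        ∑ i, ∑ j, c i * c j * (‖inner ℂ (v i) x‖ ^ 2 * ‖inner ℂ (v j) x‖ ^ 2) := fun x => by
      rw [sq, Finset.sum_mul_sum]
      exact Finset.sum_congr rfl fun i _ => Finset.sum_congr rfl fun j _ => by ring
    have hi : ∀ i j, Integrable (fun U : unitary (E →L[ℂ] E) => c i * c j *
        (‖inner ℂ (v i) ((U : E →L[ℂ] E) e)‖ ^ 2 * ‖inner ℂ (v j) ((U : E →L[ℂ] E) e)‖ ^ 2))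
        (haarUnitary E) := fun i j => integrable_haarUnitary (by fun_prop)
    simp_rw [hpt]
    rw [integral_finsetSum _ fun i _ => integrable_finsetSum _ fun j _ => hi i j]
    simp_rw [integral_finsetSum _ fun j _ => hi _ j, integral_const_mul, hprod, mul_add, mul_ite,
      mul_one, mul_zero, Finset.sum_add_distrib, Finset.sum_ite_eq, Finset.mem_univ, if_true]
    rw [sq (∑ i, c i), Finset.sum_mul_sum, Finset.mul_sum, Finset.mul_sum, add_comm]
    congr 1
    · exact Finset.sum_congr rfl fun i _ => by ring
    · refine Finset.sum_congr rfl fun i _ => ?_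
      rw [Finset.mul_sum]
      exact Finset.sum_congr rfl fun j _ => by ring
  have h1 := hgen fun _ => 1
  have h2 : ∀ U : unitary (E →L[ℂ] E),
      ∑ i, (1 : ℝ) * ‖inner ℂ (v i) ((U : E →L[ℂ] E) e)‖ ^ 2 = 1 := by
    intro U
    simp_rw [one_mul]
    rw [v.sum_sq_norm_inner_right, Unitary.norm_map, he, one_pow]
  simp_rw [h2] at h1
  simp at h1
  rw [hgen c, eq_div_iff (by positivity)]
  linear_combination (∑ i, c i ^ 2 + (∑ i, c i) ^ 2) * (-h1)

/-! ### Unitarily invariant measures -/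

theorem continuous_unitary_apply_prod :
    Continuous fun z : unitary (E →L[ℂ] E) × E => (z.1 : E →L[ℂ] E) z.2 := by
  fun_prop

variable [MeasurableSpace E] [BorelSpace E]

/-- Polar coordinates without a sphere measure: by invariance of `γ`, `x` may be replaced by U x
with U Haar-random. After Fubini, homogeneity pulls out ‖x‖, and the direction of `x` no longer
matters. -/
theorem integral_eq_integral_norm_mul {γ : Measure E} [IsProbabilityMeasure γ]
    (hγ : ∀ U : unitary (E →L[ℂ] E), γ.map (U : E →L[ℂ] E) = γ)
    (hn : Integrable (fun x => ‖x‖) γ) {F : E → ℝ} (hF : Continuous F) (hle : ∀ x, |F x| ≤ ‖x‖)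
    (hhom : ∀ (r : ℝ) x, 0 ≤ r → F ((r : ℂ) • x) = r * F x) {e : E} (he : ‖e‖ = 1) :
    ∫ x, F x ∂γ = (∫ x, ‖x‖ ∂γ) * ∫ U, F ((U : E →L[ℂ] E) e) ∂(haarUnitary E) := by
  have hcont : Continuous fun z : unitary (E →L[ℂ] E) × E => F ((z.1 : E →L[ℂ] E) z.2) :=
    hF.comp continuous_unitary_apply_prod
  have hint : Integrable (fun z : unitary (E →L[ℂ] E) × E => F ((z.1 : E →L[ℂ] E) z.2))
      ((haarUnitary E).prod γ) := by
    refine (hn.comp_snd (haarUnitary E)).mono' hcont.aestronglyMeasurable (ae_of_all _ fun z => ?_)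
    exact (hle _).trans_eq (Unitary.norm_map z.1 z.2)
  have h1 : ∫ U, ∫ x, F ((U : E →L[ℂ] E) x) ∂γ ∂(haarUnitary E) = ∫ x, F x ∂γ := by
    have : ∀ U : unitary (E →L[ℂ] E), ∫ x, F ((U : E →L[ℂ] E) x) ∂γ = ∫ x, F x ∂γ := fun U => by
      conv_rhs => rw [← hγ U]
      rw [integral_map (by fun_prop) hF.aestronglyMeasurable]
    simp [this]
  rw [← h1, integral_integral_swap hint, ← integral_mul_const]
  refine integral_congr_ae (ae_of_all _ fun x => ?_)
  simp only
  by_cases hx : x = 0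
  · have h0 : F 0 = 0 := by simpa using hhom 0 0 le_rfl
    simp [hx, h0]
  · have hx0 : ‖x‖ ≠ 0 := norm_ne_zero_iff.2 hx
    have hu : ‖((‖x‖⁻¹ : ℝ) : ℂ) • x‖ = 1 := by
      rw [norm_smul, Complex.norm_real, norm_inv, norm_norm, inv_mul_cancel₀ hx0]
    rw [← integral_haarUnitary_apply_eq F hu he, ← integral_const_mul]
    refine integral_congr_ae (ae_of_all _ fun U => ?_)
    simp only
    rw [map_smul, hhom _ _ (by positivity), mul_inv_cancel_left₀ hx0]

theorem haarUnitary_cone_le {γ : Measure E} [IsProbabilityMeasure γ]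
    (hγ : ∀ U : unitary (E →L[ℂ] E), γ.map (U : E →L[ℂ] E) = γ) {C : Set E} (hC : IsClosed C)
    (h0 : 0 ∈ C) (hcone : ∀ (r : ℝ) x, 0 ≤ r → x ∈ C → (r : ℂ) • x ∈ C) {e : E} (he : ‖e‖ = 1) :
    haarUnitary E {U | (U : E →L[ℂ] E) e ∈ C} ≤ γ C := by
  set S : Set (unitary (E →L[ℂ] E) × E) := {z | (z.1 : E →L[ℂ] E) z.2 ∈ C} with hS
  have hSm : MeasurableSet S := (hC.preimage continuous_unitary_apply_prod).measurableSet
  have h1 : ((haarUnitary E).prod γ) S = γ C := by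
    rw [Measure.prod_apply hSm]
    have : ∀ U : unitary (E →L[ℂ] E), γ (Prod.mk U ⁻¹' S) = γ C := fun U => by
      conv_rhs => rw [← hγ U]
      rw [Measure.map_apply (by fun_prop) hC.measurableSet]
      rfl
    simp [this]
  rw [← h1, Measure.prod_apply_symm hSm]
  calc haarUnitary E {U | (U : E →L[ℂ] E) e ∈ C}
      = ∫⁻ _, haarUnitary E {U | (U : E →L[ℂ] E) e ∈ C} ∂γ := by simp
    _ ≤ _ := lintegral_mono fun x => ?_
  by_cases hx : x = 0
  · have : (fun U : unitary (E →L[ℂ] E) => (U, x)) ⁻¹' S = Set.univ := by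
      ext U; simp [hS, hx, h0]
    rw [this]
    exact measure_mono (Set.subset_univ _)
  · have hx0 : ‖x‖ ≠ 0 := norm_ne_zero_iff.2 hx
    have hu : ‖((‖x‖⁻¹ : ℝ) : ℂ) • x‖ = 1 := by
      rw [norm_smul, Complex.norm_real, norm_inv, norm_norm, inv_mul_cancel₀ hx0]
    rw [haarUnitary_apply_mem_eq C he hu]
    refine measure_mono fun U hU => ?_
    have h2 := hcone ‖x‖ _ (norm_nonneg x) hU
    rw [map_smul, smul_smul, ← Complex.ofReal_mul, mul_inv_cancel₀ hx0, Complex.ofReal_one,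
      one_smul] at h2
    exact h2

end Haar

/-! ### From single vectors to subspaces by comparing volumes -/

section Subspace

theorem exists_submodule_finrank_eq {E : Type*} [AddCommGroup E] [Module ℂ E]
    [FiniteDimensional ℂ E] {n : ℕ} (hn : n ≤ Module.finrank ℂ E) :
    ∃ W : Submodule ℂ E, Module.finrank ℂ W = n := by
  let v := Module.finBasis ℂ E
  refine ⟨Submodule.span ℂ (Set.range (v ∘ Fin.castLE hn)), ?_⟩
  rw [finrank_span_eq_card (v.linearIndependent.comp _ (Fin.castLE_injective hn)),
    Fintype.card_fin]

variable {E : Type*} [NormedAddCommGroup E] [InnerProductSpace ℂ E] [FiniteDimensional ℂ E]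
  [MeasurableSpace E] [BorelSpace E]

/-- A volumetric form of the net argument: if a unit vector is unlikely to be mapped by a random
unitary to the region `F < c`, then some unitary image of `W` avoids `F < c - ε`. -/
theorem exists_unitary_forall_le (W : Submodule ℂ E) {F : E → ℝ} (hF : Continuous F)
    (hlip : ∀ x y, F x ≤ F y + ‖x - y‖) (hhom : ∀ (r : ℝ) x, 0 ≤ r → F ((r : ℂ) • x) = r * F x)
    {c ε : ℝ} (hc : 0 ≤ c) (hc1 : c ≤ 1) (hε : 0 < ε) {e : E} (he : ‖e‖ = 1)
    (hp : (haarUnitary E).real {U | F ((U : E →L[ℂ] E) e) ≤ c} <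
      (ε / (2 + ε)) ^ (2 * Module.finrank ℂ W)) :
    ∃ U : unitary (E →L[ℂ] E), ∀ v ∈ W, ‖v‖ = 1 → c - ε ≤ F ((U : E →L[ℂ] E) v) := by
  by_contra! hcon
  set p := (haarUnitary E).real {U | F ((U : E →L[ℂ] E) e) ≤ c} with hpdef
  have hp0 : 0 ≤ p := measureReal_nonneg
  let vol : Measure W := Measure.addHaar
  set B : Set W := Metric.ball 0 (1 + ε / 2) with hB
  have hcont : Continuous fun z : unitary (E →L[ℂ] E) × W => F ((z.1 : E →L[ℂ] E) z.2) :=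
    hF.comp (by fun_prop)
  set S : Set (unitary (E →L[ℂ] E) × W) :=
    {z | F ((z.1 : E →L[ℂ] E) z.2) < c * ‖z.2‖} with hS
  have hSm : MeasurableSet S := (isOpen_lt hcont (by fun_prop)).measurableSet
  -- For each U a bad unit vector v spoils the whole ball of radius ε/2 around it: at distance δ <
  -- ε/2, `F` gains at most δ and c‖u‖ falls below c by at most δ, which the margin ε absorbs.
  have hlow : vol (Metric.ball 0 (ε / 2)) ≤ ((haarUnitary E).prod (vol.restrict B)) S := by
    rw [Measure.prod_apply hSm]
    calc vol (Metric.ball 0 (ε / 2))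
        = ∫⁻ _, vol (Metric.ball 0 (ε / 2)) ∂(haarUnitary E) := by simp
      _ ≤ _ := lintegral_mono fun U => ?_
    obtain ⟨v, hv, hv1, hlt⟩ := hcon U
    rw [← Measure.addHaar_ball_center vol (⟨v, hv⟩ : W),
      Measure.restrict_apply (hSm.preimage (by fun_prop))]
    refine measure_mono fun u hu => ?_
    rw [Metric.mem_ball, dist_eq_norm] at hu
    have hu' : ‖(u : E) - v‖ < ε / 2 := hu
    have hn1 : ‖(u : E)‖ ≤ 1 + ‖(u : E) - v‖ := by
      have := norm_add_le v ((u : E) - v)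
      rwa [add_sub_cancel, hv1] at this
    have hn2 : 1 ≤ ‖(u : E)‖ + ‖(u : E) - v‖ := by
      have := norm_sub_le (u : E) ((u : E) - v)
      rwa [sub_sub_cancel, hv1] at this
    refine ⟨?_, ?_⟩
    · change F ((U : E →L[ℂ] E) u) < c * ‖(u : E)‖
      have h1 := hlip ((U : E →L[ℂ] E) u) ((U : E →L[ℂ] E) v)
      rw [← map_sub, Unitary.norm_map] at h1
      nlinarith [mul_le_mul_of_nonneg_left hn2 hc,
        mul_le_mul_of_nonneg_right hc1 (norm_nonneg ((u : E) - v))]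
    · rw [hB, mem_ball_zero_iff]
      change ‖(u : E)‖ < _
      linarith
  -- By homogeneity each fixed nonzero u is bad with probability at most `p`. The ratio of the two
  -- ball volumes, in real dimension 2 dim W, contradicts the hypothesis on `p`.
  have hup : ((haarUnitary E).prod (vol.restrict B)) S ≤ ENNReal.ofReal p * vol B := by
    rw [Measure.prod_apply_symm hSm]
    calc _ ≤ ∫⁻ _, ENNReal.ofReal p ∂(vol.restrict B) := lintegral_mono fun u => ?_
      _ = _ := by simp
    by_cases hu0 : u = 0
    · have : (fun U : unitary (E →L[ℂ] E) => (U, u)) ⁻¹' S = ∅ := by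
        ext U
        have h0 : F 0 = 0 := by simpa using hhom 0 0 le_rfl
        simp [hS, hu0, h0]
      rw [this]
      simp
    · have hn : ‖(u : E)‖ ≠ 0 := by simpa using hu0
      have hu : ‖((‖(u : E)‖⁻¹ : ℝ) : ℂ) • (u : E)‖ = 1 := by
        rw [norm_smul, Complex.norm_real, norm_inv, norm_norm, inv_mul_cancel₀ hn]
      have h1 := haarUnitary_apply_mem_eq {x | F x ≤ c} he hu
      rw [hpdef, measureReal_def, ENNReal.ofReal_toReal (measure_ne_top _ _)]
      simp only [Set.mem_ofPred_eq] at h1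
      rw [h1]
      refine measure_mono fun U hU => ?_
      have hU' : F ((U : E →L[ℂ] E) u) < c * ‖(u : E)‖ := hU
      change F ((U : E →L[ℂ] E) (((‖(u : E)‖⁻¹ : ℝ) : ℂ) • (u : E))) ≤ c
      rw [map_smul, hhom _ _ (by positivity), inv_mul_le_iff₀ (by positivity), mul_comm]
      exact hU'.le
  have h := hlow.trans hup
  rw [Measure.addHaar_ball_of_pos vol 0 (show 0 < ε / 2 by positivity), hB,
    Measure.addHaar_ball_of_pos vol 0 (show 0 < 1 + ε / 2 by positivity), ← mul_assoc,
    ← ENNReal.ofReal_mul hp0,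
    ENNReal.mul_le_mul_iff_left (Metric.measure_ball_pos _ _ one_pos).ne' measure_ball_lt_top.ne,
    ENNReal.ofReal_le_ofReal_iff (by positivity), finrank_real_of_complex] at h
  have h2 : (ε / (2 + ε)) ^ (2 * Module.finrank ℂ W) * (1 + ε / 2) ^ (2 * Module.finrank ℂ W) =
      (ε / 2) ^ (2 * Module.finrank ℂ W) := by
    rw [← mul_pow]
    congr 1
    field_simp
  rw [← h2] at h
  exact absurd (le_of_mul_le_mul_right h (by positivity)) (not_le.2 hp)

end Subspace

/-! ### Dvoretzky's theorem -/

section Levy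

theorem isNorming_sum_norm {E K ι : Type*} [NormedAddCommGroup E] [NormedSpace ℝ E]
    [NormedAddCommGroup K] [NormedSpace ℝ K] [Fintype ι] (B : ι → E →L[ℝ] K) {a : ℝ} (ha : 0 ≤ a)
    (h : ∀ x, a * ∑ i, ‖B i x‖ ≤ ‖x‖) : IsNorming fun x => a * ∑ i, ‖B i x‖ := by
  refine ⟨by fun_prop, fun x => ?_⟩
  choose l hl hlx using fun i => exists_dual_vector'' ℝ (B i x)
  set g : StrongDual ℝ E := a • ∑ i, (l i).comp (B i) with hg
  have hgz : ∀ z, g z = a * ∑ i, l i (B i z) := fun z => by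
    simp [hg]
  have habs : ∀ z, |g z| ≤ a * ∑ i, ‖B i z‖ := fun z => by
    rw [hgz, abs_mul, abs_of_nonneg ha]
    refine mul_le_mul_of_nonneg_left ((Finset.abs_sum_le_sum_abs _ _).trans
      (Finset.sum_le_sum fun i _ => ?_)) ha
    exact ((l i).le_of_opNorm_le (hl i) _).trans_eq (one_mul _)
  refine ⟨g, g.opNorm_le_bound zero_le_one fun z => ?_, fun z => (le_abs_self _).trans (habs z), ?_⟩
  · rw [one_mul]
    exact (habs z).trans (h z)
  · rw [hgz]
    simp [hlx]

variable {d : ℕ}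

theorem stdGaussian_map_unitary
    (U : unitary (EuclideanSpace ℂ (Fin d) →L[ℂ] EuclideanSpace ℂ (Fin d))) :
    (stdGaussian (EuclideanSpace ℂ (Fin d))).map
      (U : EuclideanSpace ℂ (Fin d) →L[ℂ] EuclideanSpace ℂ (Fin d)) =
    stdGaussian (EuclideanSpace ℂ (Fin d)) := by
  let f : EuclideanSpace ℂ (Fin d) ≃ₗᵢ[ℝ] EuclideanSpace ℂ (Fin d) :=
    { (Unitary.linearIsometryEquiv U).toLinearEquiv.restrictScalars ℝ with
      norm_map' := Unitary.norm_map U }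
  exact stdGaussian_map f

theorem finrank_real_euclideanSpace_complex :
    Module.finrank ℝ (EuclideanSpace ℂ (Fin d)) = 2 * d := by
  rw [finrank_real_of_complex, finrank_euclideanSpace_fin]

/-- The constant 32 is fixed here. Since D ≥ 1 and log(5/ε) ≥ 1, d ≥ 32, so b² ≥ 2d - 5 ≥ 5d/4. With
π² ≤ 10, 4π² D log(5/ε) ≤ (40/32) dε² = (5/4) dε² ≤ (εb)². The 5 in the logarithm leaves room for 2
+ ε ≤ 3. -/
theorem exp_lt_pow_of_floor {D d : ℕ} {ε b : ℝ} (hε : 0 < ε) (hε1 : ε ≤ 1)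
    (hD : 0 < D) (hDd : (D : ℝ) ≤ d * ε ^ 2 / (32 * Real.log (5 / ε)))
    (hb : 2 * (d : ℝ) - 5 ≤ b ^ 2) :
    Real.exp (-(ε * b) ^ 2 / (2 * Real.pi ^ 2)) < (ε / (2 + ε)) ^ (2 * D) := by
  have h5 : 5 ≤ 5 / ε := by rw [le_div_iff₀ hε]; linarith
  have hlog : 1 ≤ Real.log (5 / ε) := by
    rw [Real.le_log_iff_exp_le (by positivity)]
    linarith [Real.exp_one_lt_d9]
  rw [le_div_iff₀ (by positivity)] at hDd
  have hD1 : (1 : ℝ) ≤ D := by exact_mod_cast hD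
  have hd0 : (0 : ℝ) ≤ d := Nat.cast_nonneg d
  have hd : (32 : ℝ) ≤ d := by
    have e1 : d * ε ^ 2 ≤ d := mul_le_of_le_one_right hd0 (pow_le_one₀ hε.le hε1)
    linarith [mul_le_mul hD1 hlog zero_le_one (by positivity)]
  have hpi : Real.pi ^ 2 ≤ 10 := by nlinarith [Real.pi_lt_d2, Real.pi_pos]
  have h1 : -(ε * b) ^ 2 / (2 * Real.pi ^ 2) ≤ -(2 * D * Real.log (5 / ε)) := by
    rw [div_le_iff₀ (by positivity)]
    have e1 : d * ε ^ 2 * 5 / 4 ≤ (ε * b) ^ 2 := by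
      rw [mul_pow]; nlinarith [sq_nonneg ε]
    nlinarith [mul_le_mul hDd hpi (by positivity) (by positivity)]
  calc _ ≤ Real.exp (-(2 * D * Real.log (5 / ε))) := Real.exp_le_exp.2 h1
    _ = (ε / 5) ^ (2 * D) := by
        rw [← Real.exp_log (show 0 < ε / 5 by positivity), ← Real.exp_nat_mul,
          ← inv_div 5 ε, Real.log_inv]
        push_cast
        ring_nf
    _ < _ := by
        refine pow_lt_pow_left₀ ?_ (by positivity) (by omega)
        gcongr
        linarith

local notation "𝔼" => EuclideanSpace ℂ (Fin d)

/-- **Dvoretzky's theorem** for a norm `F ≤ ‖·‖` whose average over the unit sphere is at least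
`m`. -/
theorem exists_submodule_forall_le {F : 𝔼 → ℝ} (hF : IsNorming F)
    (hlip : ∀ x y, F x ≤ F y + ‖x - y‖) (hhom : ∀ (r : ℝ) x, 0 ≤ r → F ((r : ℂ) • x) = r * F x)
    {e : 𝔼} (he : ‖e‖ = 1) {m ε : ℝ} (hm1 : m ≤ 1)
    (hm : m ≤ ∫ U, F ((U : 𝔼 →L[ℂ] 𝔼) e)
      ∂(haarUnitary (𝔼)))
    (hε : 0 < ε) (hε1 : ε ≤ 1) (hεm : 2 * ε ≤ m) {D : ℕ} (hD : 0 < D) (hDle : D ≤ d)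
    (hDd : (D : ℝ) ≤ d * ε ^ 2 / (32 * Real.log (5 / ε))) :
    ∃ V : Submodule ℂ (𝔼), Module.finrank ℂ V = D ∧
      ∀ α ∈ V, ‖α‖ = 1 → m - 2 * ε ≤ F α := by
  have hc0 : 0 ≤ m - ε := by linarith
  have hc1 : m - ε ≤ 1 := by linarith
  have hmean := integral_eq_integral_norm_mul (γ := stdGaussian 𝔼) stdGaussian_map_unitary
    isNorming_norm.integrable hF.1 hF.abs_le_norm hhom he
  have hb0 : 0 ≤ ∫ x : 𝔼, ‖x‖ ∂(stdGaussian 𝔼) := integral_nonneg fun x => norm_nonneg x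
  -- The spherical mean `m` turns into a gap between Gaussian means, so the threshold m - ε costs
  -- the first ε. The volume argument below costs the second.
  have hcone := hF.measureReal_cone_le hε.le hc0 hc1 (by
    rw [hmean, sub_add_cancel, mul_comm]
    exact mul_le_mul_of_nonneg_left hm hb0)
  have hF0 : F 0 = 0 := by simpa using hhom 0 0 le_rfl
  have hcl : IsClosed {x : 𝔼 | F x ≤ (m - ε) * ‖x‖} := isClosed_le hF.1 (by fun_prop)
  have hp := haarUnitary_cone_le (γ := stdGaussian 𝔼) stdGaussian_map_unitary hcl (by simp [hF0])
    (fun r x hr hx => by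
      simp only [Set.mem_ofPred_eq] at hx ⊢
      rw [hhom r x hr, norm_smul, Complex.norm_real, Real.norm_of_nonneg hr]
      nlinarith [mul_le_mul_of_nonneg_left hx hr]) he
  have hset : {U : unitary (𝔼 →L[ℂ] 𝔼) | (U : 𝔼 →L[ℂ] 𝔼) e ∈ {x : 𝔼 | F x ≤ (m - ε) * ‖x‖}} =
      {U : unitary (𝔼 →L[ℂ] 𝔼) | F ((U : 𝔼 →L[ℂ] 𝔼) e) ≤ m - ε} := by
    ext U
    simp only [Set.mem_ofPred_eq]
    rw [Unitary.norm_map, he, mul_one]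
  rw [hset] at hp
  have hdim := finrank_sub_five_le (E := 𝔼)
  rw [finrank_real_euclideanSpace_complex] at hdim
  push_cast at hdim
  obtain ⟨W, hW⟩ := exists_submodule_finrank_eq (E := 𝔼) (n := D)
    (by rwa [finrank_euclideanSpace_fin])
  obtain ⟨U, hU⟩ := exists_unitary_forall_le W hF.1 hlip hhom hc0 hc1 hε he (by
    rw [hW]
    refine lt_of_le_of_lt ?_ (exp_lt_pow_of_floor hε hε1 hD hDd hdim)
    exact (ENNReal.toReal_mono (measure_ne_top _ _) hp).trans hcone)
  refine ⟨W.map ((Unitary.linearIsometryEquiv U).toLinearEquiv : 𝔼 →ₗ[ℂ] 𝔼), ?_, ?_⟩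
  · rw [← hW]
    exact LinearEquiv.finrank_map_eq _ W
  · rintro _ ⟨v, hv, rfl⟩ hn
    have hn' : ‖v‖ = 1 := by rw [← hn]; exact (Unitary.norm_map U v).symm
    have := hU v hv hn'
    change m - 2 * ε ≤ F ((U : 𝔼 →L[ℂ] 𝔼) v)
    linarith

end Levy

/-! ### State, costs and fidelity of the protocol -/

section Protocol

variable {d κ : ℕ}

theorem norm_smul_bVec [NeZero κ] (U : Fin κ → Matrix.unitaryGroup (Fin d) ℂ)
    (α : EuclideanSpace ℂ (Fin d)) (x : Fin d) :
    (‖block U α x‖ : ℂ) • bVec U α x = block U α x := by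
  unfold bVec
  split_ifs with h
  · simp [h]
  · rw [smul_inv_smul₀]
    simpa using h

theorem state_erased [NeZero κ] (U : Fin κ → Matrix.unitaryGroup (Fin d) ℂ)
    (α : EuclideanSpace ℂ (Fin d)) (k : Fin κ) (x y : Fin d) :
    (Protocol.alice (.ebits d .start) (encode U) (encode_isometry U)).state α
      ((((), k), x), ((), y)) = if x = y then bVec U α y k * ((Real.sqrt d)⁻¹ : ℂ) else 0 := by
  simp only [Protocol.state, encode, Matrix.of_apply, Fintype.sum_prod_type, Finset.univ_unique,
    Finset.sum_singleton, one_mul, ite_mul, zero_mul, Finset.sum_ite_eq, Finset.mem_univ, if_true]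
  split_ifs with h
  · rw [h]
  · simp

theorem state_rsp [NeZero κ] (U : Fin κ → Matrix.unitaryGroup (Fin d) ℂ)
    (α : EuclideanSpace ℂ (Fin d)) (x : Fin d) (k : Fin κ) :
    (rsp U).state α ((), (x, k)) =
      ∑ y, conj ((U k : Matrix (Fin d) (Fin d) ℂ) y x) *
        (bVec U α y k * ((Real.sqrt d)⁻¹ : ℂ)) := by
  have h : ∀ (y : Fin d) (l : Fin κ),
      (Protocol.qubits κ (.coCobits d (.alice (.ebits d .start) (encode U)
        (encode_isometry U)))).state α ((), (((), y), l)) =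
        bVec U α y l * ((Real.sqrt d)⁻¹ : ℂ) := fun y l => by
    have := state_erased U α l y y
    rw [if_pos rfl] at this
    exact this
  rw [rsp, Protocol.state]
  simp only [decode, Matrix.of_apply, Matrix.conjTranspose_apply, Fintype.sum_prod_type,
    Finset.univ_unique, Finset.sum_singleton, ite_mul, zero_mul, Finset.sum_ite_eq,
    Finset.mem_univ, if_true]
  exact Finset.sum_congr rfl fun y _ => by rw [← h]; rfl

theorem valid_rsp [NeZero d] [NeZero κ] (U : Fin κ → Matrix.unitaryGroup (Fin d) ℂ)
    (α : EuclideanSpace ℂ (Fin d)) : (rsp U).Valid α := by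
  refine ⟨⟨Nat.pos_of_ne_zero (NeZero.ne d), trivial⟩, ?_⟩
  rintro ⟨⟨⟩, k⟩ ⟨⟩ x y hxy
  exact (state_erased U α k x y).trans (if_neg hxy)

theorem coCobitCost_rsp [NeZero κ] (U : Fin κ → Matrix.unitaryGroup (Fin d) ℂ) :
    (rsp U).coCobitCost = Real.logb 2 d := by
  simp [rsp, Protocol.coCobitCost]

theorem ebitCost_rsp [NeZero κ] (U : Fin κ → Matrix.unitaryGroup (Fin d) ℂ) :
    (rsp U).ebitCost = Real.logb 2 d := by
  simp [rsp, Protocol.ebitCost]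

theorem qubitCost_rsp [NeZero κ] (U : Fin κ → Matrix.unitaryGroup (Fin d) ℂ) :
    (rsp U).qubitCost = Real.logb 2 κ := by
  simp [rsp, Protocol.qubitCost]

/-- The overlap `d^{-1/2} ∑ x, β_x` of `|β⟩` with the state prepared by Alice's encoding. -/
noncomputable def overlap (U : Fin κ → Matrix.unitaryGroup (Fin d) ℂ)
    (α : EuclideanSpace ℂ (Fin d)) : ℝ :=
  (Real.sqrt d)⁻¹ * ∑ x, ‖block U α x‖

/-- Moving U_k† onto α turns its conjugate into √κ β_y times the conjugate of (b_y)_k. The phases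
cancel and the amplitude is real and nonnegative. -/
theorem sum_conj_mul_state_rsp [NeZero κ] (U : Fin κ → Matrix.unitaryGroup (Fin d) ℂ)
    (α : EuclideanSpace ℂ (Fin d)) (k : Fin κ) :
    ∑ x, conj (α x) * (rsp U).state α ((), (x, k)) =
      (((Real.sqrt d)⁻¹ * (Real.sqrt κ * ∑ y, ‖block U α y‖ * ‖bVec U α y k‖ ^ 2) : ℝ) : ℂ) := by
  have hκ : (Real.sqrt κ : ℂ) ≠ 0 := by
    simpa using NeZero.ne κ
  have h1 : ∀ y, conj (((U k : Matrix (Fin d) (Fin d) ℂ) *ᵥ α.ofLp) y) =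
      Real.sqrt κ * (‖block U α y‖ * conj (bVec U α y k)) := by
    intro y
    have h := congrArg (fun v : EuclideanSpace ℂ (Fin κ) => v k) (norm_smul_bVec U α y)
    simp only [block, PiLp.smul_apply, smul_eq_mul] at h
    have h2 : ((U k : Matrix (Fin d) (Fin d) ℂ) *ᵥ α.ofLp) y =
        Real.sqrt κ * (‖block U α y‖ * bVec U α y k) := by
      simp only [block]
      rw [h, mul_inv_cancel_left₀ hκ]
    rw [h2]
    simp
  calc _ = ∑ y, conj (((U k : Matrix (Fin d) (Fin d) ℂ) *ᵥ α.ofLp) y) *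
        (bVec U α y k * ((Real.sqrt d)⁻¹ : ℂ)) := by
        simp_rw [state_rsp, Finset.mul_sum, Matrix.mulVec, dotProduct, map_sum, map_mul,
          Finset.sum_mul]
        rw [Finset.sum_comm]
        exact Finset.sum_congr rfl fun y _ => Finset.sum_congr rfl fun x _ => by ring
    _ = _ := by
        simp_rw [h1]
        push_cast
        rw [Finset.mul_sum, Finset.mul_sum]
        refine Finset.sum_congr rfl fun y _ => ?_
        rw [← Complex.conj_mul']
        ring

/-- The squared fidelity is ∑ a_k² over the values k of the discarded register, while ∑ a_k is √κ
times the overlap because every b_y is a unit vector. Cauchy–Schwarz over the κ values compares the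
two. -/
theorem overlap_le_fidelity [NeZero κ] (U : Fin κ → Matrix.unitaryGroup (Fin d) ℂ)
    (α : EuclideanSpace ℂ (Fin d)) : overlap U α ≤ fidelity α ((rsp U).bobOutput α) := by
  set a : Fin κ → ℝ := fun k =>
    (Real.sqrt d)⁻¹ * (Real.sqrt κ * ∑ y, ‖block U α y‖ * ‖bVec U α y k‖ ^ 2) with ha
  have h1 : ∑ x, ∑ y, conj (α x) * (rsp U).bobOutput α x y * α y = ((∑ k, a k ^ 2 : ℝ) : ℂ) := by
    have : ∀ k, ((a k ^ 2 : ℝ) : ℂ) = (∑ x, conj (α x) * (rsp U).state α ((), (x, k))) *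
        conj (∑ x, conj (α x) * (rsp U).state α ((), (x, k))) := fun k => by
      rw [sum_conj_mul_state_rsp, Complex.conj_ofReal, ← Complex.ofReal_mul, ← sq]
    rw [Complex.ofReal_sum]
    simp_rw [this, map_sum, Finset.sum_mul_sum, map_mul, Complex.conj_conj]
    have e : ∀ x y, conj (α x) * (rsp U).bobOutput α x y * α y =
        ∑ k, conj (α x) * (rsp U).state α ((), (x, k)) *
          (α y * conj ((rsp U).state α ((), (y, k)))) := fun x y => by
      simp only [Protocol.bobOutput, Matrix.of_apply, Finset.univ_unique, Finset.sum_singleton,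
        Finset.mul_sum, Finset.sum_mul]
      exact Finset.sum_congr rfl fun k _ => by ring
    simp_rw [e]
    exact (Finset.sum_congr rfl fun x _ => Finset.sum_comm).trans Finset.sum_comm
  have hκ : (0 : ℝ) < κ := by exact_mod_cast Nat.pos_of_ne_zero (NeZero.ne κ)
  have h2 : ∑ k, a k = Real.sqrt κ * overlap U α := by
    simp only [ha, overlap]
    rw [← Finset.mul_sum, ← Finset.mul_sum, Finset.sum_comm]
    have : ∀ y, ∑ k, ‖block U α y‖ * ‖bVec U α y k‖ ^ 2 = ‖block U α y‖ := fun y => by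
      rw [← Finset.mul_sum, ← EuclideanSpace.norm_sq_eq, norm_bVec, one_pow, mul_one]
    simp_rw [this]
    ring
  have h3 : (∑ k, a k) ^ 2 ≤ κ * ∑ k, a k ^ 2 := by
    simpa using sq_sum_le_card_mul_sum_sq (s := (Finset.univ : Finset (Fin κ))) (f := a)
  rw [h2, mul_pow, Real.sq_sqrt hκ.le] at h3
  unfold fidelity
  rw [h1, Complex.ofReal_re]
  exact Real.le_sqrt_of_sq_le (le_of_mul_le_mul_left h3 hκ)

/-! ### Linearity of the blocks and multiplicities of the shifts -/

theorem block_add (U : Fin κ → Matrix.unitaryGroup (Fin d) ℂ) (α β : EuclideanSpace ℂ (Fin d))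
    (x : Fin d) : block U (α + β) x = block U α x + block U β x := by
  ext k
  simp [block, Matrix.mulVec_add, mul_add]

theorem block_smul (U : Fin κ → Matrix.unitaryGroup (Fin d) ℂ) (c : ℂ)
    (α : EuclideanSpace ℂ (Fin d)) (x : Fin d) : block U (c • α) x = c • block U α x := by
  ext k
  simp only [block, WithLp.ofLp_smul, Matrix.mulVec_smul, Pi.smul_apply, PiLp.smul_apply,
    smul_eq_mul]
  ring

theorem norm_block_sq (U : Fin κ → Matrix.unitaryGroup (Fin d) ℂ)
    (α : EuclideanSpace ℂ (Fin d)) (x : Fin d) :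
    ‖block U α x‖ ^ 2 =
      (κ : ℝ)⁻¹ * ∑ k, ‖((U k : Matrix (Fin d) (Fin d) ℂ) *ᵥ α.ofLp) x‖ ^ 2 := by
  rw [EuclideanSpace.norm_sq_eq, Finset.mul_sum]
  refine Finset.sum_congr rfl fun k _ => ?_
  simp only [block, norm_mul, norm_inv, Complex.norm_real, Real.norm_eq_abs, mul_pow, inv_pow,
    sq_abs]
  rw [Real.sq_sqrt (Nat.cast_nonneg κ)]

theorem shifts_mulVec [NeZero d] (k : Fin κ) (v : Fin d → ℂ) (y : Fin d) :
    ((shifts d κ k : Matrix (Fin d) (Fin d) ℂ) *ᵥ v) y = v (y - Fin.ofNat d (k.val + 1)) := by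
  simp only [shifts, shift, Matrix.mulVec, dotProduct, Matrix.of_apply, ite_mul, one_mul, zero_mul]
  simp_rw [← sub_eq_iff_eq_add]
  simp

/-- The number of shifts that take `x` to `y`. -/
def shiftCount (d κ : ℕ) [NeZero d] (y x : Fin d) : ℕ :=
  (Finset.univ.filter fun k : Fin κ => y - Fin.ofNat d (k.val + 1) = x).card

theorem norm_block_shifts_sq [NeZero d] (α : EuclideanSpace ℂ (Fin d)) (y : Fin d) :
    ‖block (shifts d κ) α y‖ ^ 2 = (κ : ℝ)⁻¹ * ∑ x, shiftCount d κ y x * ‖α x‖ ^ 2 := by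
  rw [norm_block_sq]
  congr 1
  simp_rw [shifts_mulVec]
  rw [← Finset.sum_fiberwise (s := Finset.univ)
    (g := fun k : Fin κ => y - Fin.ofNat d (k.val + 1))]
  refine Finset.sum_congr rfl fun x _ => ?_
  rw [Finset.sum_congr rfl fun k hk => by rw [(Finset.mem_filter.1 hk).2], Finset.sum_const,
    nsmul_eq_mul]
  rfl

theorem sum_shiftCount [NeZero d] (y : Fin d) : ∑ x, shiftCount d κ y x = κ := by
  have := Finset.card_eq_sum_card_fiberwise (s := (Finset.univ : Finset (Fin κ)))
    (t := Finset.univ) (f := fun k : Fin κ => y - Fin.ofNat d (k.val + 1)) (by simp)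
  simpa [shiftCount] using this.symm

theorem sum_shiftCount_left [NeZero d] (x : Fin d) : ∑ y, shiftCount d κ y x = κ := by
  simp_rw [shiftCount, Finset.card_filter]
  rw [Finset.sum_comm]
  simp [sub_eq_iff_eq_add]

/-- Among κ consecutive integers each residue class mod d occurs ⌊κ/d⌋ or ⌊κ/d⌋ + 1 times. This
covers κ > d, where shifts repeat. -/
theorem shiftCount_eq [NeZero d] (y x : Fin d) :
    shiftCount d κ y x = κ / d ∨ shiftCount d κ y x = κ / d + 1 := by
  have hd : 0 < d := Nat.pos_of_ne_zero (NeZero.ne d)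
  have hiff : ∀ k : ℕ, y - Fin.ofNat d (k + 1) = x ↔ k ≡ (y - x).val + (d - 1) [MOD d] := by
    intro k
    have hsub : y - Fin.ofNat d (k + 1) = x ↔ Fin.ofNat d (k + 1) = y - x :=
      ⟨fun h => by rw [← h, sub_sub_cancel], fun h => by rw [h, sub_sub_cancel]⟩
    rw [hsub, Fin.ext_iff, Fin.val_ofNat,
      show ((k + 1) % d = (y - x).val) ↔ k + 1 ≡ (y - x).val + d [MOD d] by
        rw [Nat.ModEq, Nat.add_mod_right, Nat.mod_eq_of_lt (y - x).isLt]]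
    have : (y - x).val + d = (y - x).val + (d - 1) + 1 := by omega
    rw [this]
    exact ⟨Nat.ModEq.add_right_cancel' 1, Nat.ModEq.add_right 1⟩
  have h : shiftCount d κ y x = κ.count (· ≡ (y - x).val + (d - 1) [MOD d]) := by
    rw [Nat.count_eq_card_filter_range, shiftCount]
    refine Finset.card_bij (fun k _ => k.val) (fun k hk => ?_) (fun k _ l _ => Fin.ext)
      fun k hk => ?_
    · rw [Finset.mem_filter, Finset.mem_range]
      exact ⟨k.isLt, (hiff k).1 (Finset.mem_filter.1 hk).2⟩
    · rw [Finset.mem_filter, Finset.mem_range] at hk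
      exact ⟨⟨k, hk.1⟩, Finset.mem_filter.2 ⟨Finset.mem_univ _, (hiff k).2 hk.2⟩, rfl⟩
  rw [h, Nat.count_modEq_card _ hd]
  split_ifs <;> simp

theorem sum_norm_block_shifts_sq [NeZero d] [NeZero κ] (α : EuclideanSpace ℂ (Fin d)) :
    ∑ y, ‖block (shifts d κ) α y‖ ^ 2 = ‖α‖ ^ 2 := by
  have hκ : (κ : ℝ) ≠ 0 := by exact_mod_cast NeZero.ne κ
  simp_rw [norm_block_shifts_sq]
  rw [← Finset.mul_sum, Finset.sum_comm, EuclideanSpace.norm_sq_eq, Finset.mul_sum]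
  refine Finset.sum_congr rfl fun x _ => ?_
  rw [← Finset.sum_mul, ← Nat.cast_sum, sum_shiftCount_left, inv_mul_cancel_left₀ hκ]

/-- This is the variance of dβ_y² for a Haar-random unit vector, by the fourth moment formula with
coefficients of sum zero. -/
theorem sum_shiftCount_sq_le [NeZero d] [NeZero κ] (y : Fin d) :
    (∑ x, ((d : ℝ) * shiftCount d κ y x / κ - 1) ^ 2) / ((d : ℝ) * (d + 1)) ≤
      1 / (κ : ℝ) := by
  have hκ : (0 : ℝ) < κ := by exact_mod_cast Nat.pos_of_ne_zero (NeZero.ne κ)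
  have hd : (0 : ℝ) < d := by exact_mod_cast Nat.pos_of_ne_zero (NeZero.ne d)
  set q : ℝ := ((κ / d : ℕ) : ℝ) with hq
  have hq0 : 0 ≤ q := Nat.cast_nonneg _
  have hs : ∑ x, (shiftCount d κ y x : ℝ) = κ := by exact_mod_cast sum_shiftCount y
  have hpt : ∀ x, ((d : ℝ) * shiftCount d κ y x / κ - 1) ^ 2 =
      ((d : ℝ) ^ 2 * (2 * q + 1) / (κ : ℝ) ^ 2 - 2 * d / κ) * shiftCount d κ y x +
        (1 - (d : ℝ) ^ 2 * (q * (q + 1)) / (κ : ℝ) ^ 2) := fun x => by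
    -- As the count takes only two consecutive values, its square is an affine function of it, and
    -- the known total κ evaluates the sum.
    have h0 : ((shiftCount d κ y x : ℝ) - q) * (shiftCount d κ y x - (q + 1)) = 0 := by
      rcases shiftCount_eq (κ := κ) y x with h | h <;> rw [h, hq] <;> push_cast <;> ring
    field_simp
    linear_combination (d : ℝ) ^ 2 * h0
  simp_rw [hpt, Finset.sum_add_distrib, ← Finset.mul_sum, hs]
  rw [Finset.sum_const, Finset.card_univ, Fintype.card_fin, nsmul_eq_mul, div_le_div_iff₀
    (by positivity) hκ]
  have : ((d : ℝ) ^ 2 * (2 * q + 1) / (κ : ℝ) ^ 2 - 2 * d / κ) * κ +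
      d * (1 - (d : ℝ) ^ 2 * (q * (q + 1)) / (κ : ℝ) ^ 2) =
      (d / (κ : ℝ) ^ 2) *
        (d * (2 * q + 1) * κ - (κ : ℝ) ^ 2 - (d : ℝ) ^ 2 * (q * (q + 1))) := by
    field_simp; ring
  rw [this, div_mul_eq_mul_div, div_mul_eq_mul_div, div_le_iff₀ (by positivity)]
  have h1 : d * (2 * q + 1) * κ - (κ : ℝ) ^ 2 - (d : ℝ) ^ 2 * (q * (q + 1)) ≤ (d + 1) * κ := by
    nlinarith [sq_nonneg ((κ : ℝ) - d * q), mul_nonneg (sq_nonneg (d : ℝ)) hq0]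
  have h2 : (0 : ℝ) ≤ d * κ := by positivity
  nlinarith [mul_le_mul_of_nonneg_left h1 h2]

/-! ### The overlap as a norm -/

theorem overlap_smul (U : Fin κ → Matrix.unitaryGroup (Fin d) ℂ) (r : ℝ)
    (α : EuclideanSpace ℂ (Fin d)) (hr : 0 ≤ r) : overlap U ((r : ℂ) • α) = r * overlap U α := by
  simp only [overlap, block_smul, norm_smul, Complex.norm_real, Real.norm_of_nonneg hr]
  rw [← Finset.mul_sum]
  ring

theorem overlap_add_le (U : Fin κ → Matrix.unitaryGroup (Fin d) ℂ)
    (α β : EuclideanSpace ℂ (Fin d)) : overlap U (α + β) ≤ overlap U α + overlap U β := by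
  simp only [overlap, block_add]
  rw [← mul_add, ← Finset.sum_add_distrib]
  gcongr
  exact norm_add_le _ _

theorem overlap_le_norm [NeZero d] [NeZero κ] (α : EuclideanSpace ℂ (Fin d)) :
    overlap (shifts d κ) α ≤ ‖α‖ := by
  have hd : (0 : ℝ) < d := by exact_mod_cast Nat.pos_of_ne_zero (NeZero.ne d)
  refine le_of_sq_le_sq ?_ (norm_nonneg _)
  have h := sq_sum_le_card_mul_sum_sq (s := (Finset.univ : Finset (Fin d)))
    (f := fun y => ‖block (shifts d κ) α y‖)
  rw [sum_norm_block_shifts_sq, Finset.card_univ, Fintype.card_fin] at h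
  rw [overlap, mul_pow, inv_pow, Real.sq_sqrt hd.le, inv_mul_le_iff₀ hd]
  exact h

theorem overlap_le_add_norm_sub [NeZero d] [NeZero κ] (α β : EuclideanSpace ℂ (Fin d)) :
    overlap (shifts d κ) α ≤ overlap (shifts d κ) β + ‖α - β‖ := by
  have h := overlap_add_le (shifts d κ) β (α - β)
  rw [add_sub_cancel] at h
  linarith [overlap_le_norm (κ := κ) (α - β)]

theorem isNorming_overlap [NeZero d] [NeZero κ] : IsNorming (overlap (shifts d κ)) := by
  let B : Fin d → EuclideanSpace ℂ (Fin d) →ₗ[ℝ] EuclideanSpace ℂ (Fin κ) := fun y =>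
    { toFun := fun α => block (shifts d κ) α y
      map_add' := fun α β => block_add _ α β y
      map_smul' := fun r α => block_smul _ (r : ℂ) α y }
  exact isNorming_sum_norm (fun y => (B y).toContinuousLinearMap)
    (inv_nonneg.2 (Real.sqrt_nonneg d)) (overlap_le_norm (κ := κ))

/-- Put t = √d β_y. For t ≥ 0, t ≥ 1/2 + t²/2 - (t² - 1)²/2, the difference being t(t - 1)²(t +
2)/2. Averaging over y with ∑ β_y² = 1 leaves 1 minus half the mean square deviation. -/
theorem one_sub_le_overlap [NeZero d] [NeZero κ] {α : EuclideanSpace ℂ (Fin d)} (hα : ‖α‖ = 1) :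
    1 - (1 / (2 * d)) * ∑ y, (d * ‖block (shifts d κ) α y‖ ^ 2 - 1) ^ 2 ≤
      overlap (shifts d κ) α := by
  have hd : (0 : ℝ) < d := by exact_mod_cast Nat.pos_of_ne_zero (NeZero.ne d)
  have hsd : Real.sqrt d * Real.sqrt d = d := Real.mul_self_sqrt hd.le
  have hsd0 : 0 < Real.sqrt d := Real.sqrt_pos.2 hd
  have hs := sum_norm_block_shifts_sq (κ := κ) α
  rw [hα, one_pow] at hs
  set b : Fin d → ℝ := fun y => ‖block (shifts d κ) α y‖ with hb
  have hpt : ∀ y, 1 / 2 + d / 2 * b y ^ 2 - 1 / 2 * (d * b y ^ 2 - 1) ^ 2 ≤ Real.sqrt d * b y := by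
    intro y
    set t := Real.sqrt d * b y with ht
    have ht0 : 0 ≤ t := mul_nonneg hsd0.le (norm_nonneg _)
    have ht2 : d * b y ^ 2 = t ^ 2 := by rw [ht, mul_pow, Real.sq_sqrt hd.le]
    have : t - (1 / 2 + t ^ 2 / 2 - 1 / 2 * (t ^ 2 - 1) ^ 2) = t * (t - 1) ^ 2 * (t + 2) / 2 := by
      ring
    have h2 : 0 ≤ t * (t - 1) ^ 2 * (t + 2) / 2 := by positivity
    have h3 : d / 2 * b y ^ 2 = t ^ 2 / 2 := by rw [← ht2]; ring
    rw [ht2, h3]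
    linarith
  have h := Finset.sum_le_sum fun y (_ : y ∈ Finset.univ) => hpt y
  rw [Finset.sum_sub_distrib, Finset.sum_add_distrib, ← Finset.mul_sum, ← Finset.mul_sum,
    ← Finset.mul_sum, hs, Finset.sum_const, Finset.card_univ, Fintype.card_fin,
    nsmul_eq_mul] at h
  have h4 : overlap (shifts d κ) α = (1 / d) * (Real.sqrt d * ∑ y, b y) := by
    rw [overlap, ← mul_assoc]
    congr 1
    refine (eq_inv_of_mul_eq_one_left ?_).symm
    rw [mul_assoc, hsd, one_div, inv_mul_cancel₀ hd.ne']
  have h5 : 1 - (1 / (2 * (d : ℝ))) * ∑ y, (d * b y ^ 2 - 1) ^ 2 =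
      (1 / d) * (d * (1 / 2) + d / 2 * 1 - 1 / 2 * ∑ y, (d * b y ^ 2 - 1) ^ 2) := by
    field_simp
    ring
  rw [h4, h5]
  exact mul_le_mul_of_nonneg_left h (by positivity)

theorem one_sub_le_integral_overlap [NeZero d] [NeZero κ] {e : EuclideanSpace ℂ (Fin d)}
    (he : ‖e‖ = 1) :
    1 - 1 / (2 * (κ : ℝ)) ≤
      ∫ U, overlap (shifts d κ)
        ((U : EuclideanSpace ℂ (Fin d) →L[ℂ] EuclideanSpace ℂ (Fin d)) e)
        ∂(haarUnitary (EuclideanSpace ℂ (Fin d))) := by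
  have hκ : (0 : ℝ) < κ := by exact_mod_cast Nat.pos_of_ne_zero (NeZero.ne κ)
  have hd : (0 : ℝ) < d := by exact_mod_cast Nat.pos_of_ne_zero (NeZero.ne d)
  set v := EuclideanSpace.basisFun (Fin d) ℂ with hv
  set T : Fin d → EuclideanSpace ℂ (Fin d) → ℝ := fun y x =>
    (∑ i, ((d : ℝ) * shiftCount d κ y i / κ - 1) * ‖inner ℂ (v i) x‖ ^ 2) ^ 2 with hT
  have hTeq : ∀ x : EuclideanSpace ℂ (Fin d), ‖x‖ = 1 → ∀ y,
      (d * ‖block (shifts d κ) x y‖ ^ 2 - 1) ^ 2 = T y x := by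
    intro x hx y
    have h1 : ∑ i, ‖x i‖ ^ 2 = 1 := by rw [← EuclideanSpace.norm_sq_eq, hx, one_pow]
    simp only [hT, hv, EuclideanSpace.basisFun_inner, sub_mul, one_mul, Finset.sum_sub_distrib]
    rw [h1, norm_block_shifts_sq, ← mul_assoc, Finset.mul_sum]
    congr 2
    exact Finset.sum_congr rfl fun i _ => by ring
  have hTint : ∀ y, Integrable (fun U : unitary (EuclideanSpace ℂ (Fin d) →L[ℂ]
      EuclideanSpace ℂ (Fin d)) => T y ((U : EuclideanSpace ℂ (Fin d) →L[ℂ]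
        EuclideanSpace ℂ (Fin d)) e)) (haarUnitary (EuclideanSpace ℂ (Fin d))) :=
    fun y => integrable_haarUnitary (by fun_prop)
  have hTle : ∀ y, ∫ U, T y ((U : EuclideanSpace ℂ (Fin d) →L[ℂ] EuclideanSpace ℂ (Fin d)) e)
      ∂(haarUnitary (EuclideanSpace ℂ (Fin d))) ≤ 1 / κ := by
    intro y
    have h0 : ∑ i, ((d : ℝ) * shiftCount d κ y i / κ - 1) = 0 := by
      have hs : ∑ x, (shiftCount d κ y x : ℝ) = κ := by exact_mod_cast sum_shiftCount y
      rw [Finset.sum_sub_distrib, ← Finset.sum_div, ← Finset.mul_sum, hs]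
      simp
    have h := integral_sum_mul_norm_inner_sq_sq v he
      (fun i => (d : ℝ) * shiftCount d κ y i / κ - 1)
    simp only [hT]
    rw [h, h0, Fintype.card_fin]
    simpa using sum_shiftCount_sq_le (κ := κ) y
  calc 1 - 1 / (2 * (κ : ℝ))
      = 1 - (1 / (2 * d)) * ∑ _y : Fin d, 1 / (κ : ℝ) := by
        simp
        field_simp
    _ ≤ 1 - (1 / (2 * d)) * ∑ y, ∫ U, T y ((U : EuclideanSpace ℂ (Fin d) →L[ℂ]
          EuclideanSpace ℂ (Fin d)) e) ∂(haarUnitary (EuclideanSpace ℂ (Fin d))) := by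
        gcongr with y
        exact hTle y
    _ = ∫ U, (1 - (1 / (2 * d)) * ∑ y, T y ((U : EuclideanSpace ℂ (Fin d) →L[ℂ]
          EuclideanSpace ℂ (Fin d)) e)) ∂(haarUnitary (EuclideanSpace ℂ (Fin d))) := by
        rw [integral_sub (integrable_const _)
          ((integrable_finsetSum _ fun y _ => hTint y).const_mul _), integral_const_mul,
          integral_finsetSum _ fun y _ => hTint y]
        simp
    _ ≤ _ := by
        refine integral_mono ((integrable_const _).sub
          ((integrable_finsetSum _ fun y _ => hTint y).const_mul _))
          (integrable_haarUnitary (isNorming_overlap.1.comp (by fun_prop))) fun U => ?_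
        have hn : ‖(U : EuclideanSpace ℂ (Fin d) →L[ℂ] EuclideanSpace ℂ (Fin d)) e‖ = 1 := by
          rw [Unitary.norm_map, he]
        have h := one_sub_le_overlap (κ := κ) hn
        simp_rw [hTeq _ hn] at h
        exact h

end Protocol

end RemotePrep

/-! ### Assembly of the theorem -/

theorem mainTheorem10 (d κ : ℕ) [NeZero d] [NeZero κ] (ε : ℝ) (hε : 0 < ε) (hε1 : ε ≤ 1) :
    (RemotePrep.rsp (RemotePrep.shifts d κ)).coCobitCost = Real.logb 2 d ∧
    (RemotePrep.rsp (RemotePrep.shifts d κ)).ebitCost = Real.logb 2 d ∧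
    (RemotePrep.rsp (RemotePrep.shifts d κ)).qubitCost = Real.logb 2 κ ∧
    ∃ V : Submodule ℂ (EuclideanSpace ℂ (Fin d)),
      Module.finrank ℂ V = ⌊(d : ℝ) * ε ^ 2 / (32 * Real.log (5 / ε))⌋₊ ∧
      ∀ α ∈ V, ‖α‖ = 1 →
        (RemotePrep.rsp (RemotePrep.shifts d κ)).Valid α ∧
        1 - 1 / (2 * (κ : ℝ)) - 2 * ε ≤
          RemotePrep.fidelity α ((RemotePrep.rsp (RemotePrep.shifts d κ)).bobOutput α) := by
  refine ⟨RemotePrep.coCobitCost_rsp _, RemotePrep.ebitCost_rsp _, RemotePrep.qubitCost_rsp _, ?_⟩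
  have hd0 : (0 : ℝ) ≤ d := Nat.cast_nonneg d
  have hlog : 1 ≤ Real.log (5 / ε) := by
    rw [Real.le_log_iff_exp_le (by positivity), le_div_iff₀ hε]
    nlinarith [Real.exp_one_lt_d9, Real.exp_pos 1]
  set D := ⌊(d : ℝ) * ε ^ 2 / (32 * Real.log (5 / ε))⌋₊ with hD
  have hDd : (D : ℝ) ≤ d * ε ^ 2 / (32 * Real.log (5 / ε)) := Nat.floor_le (by positivity)
  have hDle : D ≤ d := by
    have : (D : ℝ) ≤ d := hDd.trans (by
      rw [div_le_iff₀ (by positivity)]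
      exact mul_le_mul_of_nonneg_left ((pow_le_one₀ hε.le hε1).trans (by linarith)) hd0)
    exact_mod_cast this
  suffices h : ∃ V : Submodule ℂ (EuclideanSpace ℂ (Fin d)), Module.finrank ℂ V = D ∧
      ∀ α ∈ V, ‖α‖ = 1 → 1 - 1 / (2 * (κ : ℝ)) - 2 * ε ≤
        RemotePrep.fidelity α ((RemotePrep.rsp (RemotePrep.shifts d κ)).bobOutput α) by
    obtain ⟨V, hV, h⟩ := h
    exact ⟨V, hV, fun α hα hn => ⟨RemotePrep.valid_rsp _ α, h α hα hn⟩⟩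
  -- Otherwise the fidelity bound is negative and any subspace of dimension `D` will do.
  by_cases hm : 2 * ε ≤ 1 - 1 / (2 * (κ : ℝ))
  · rcases Nat.eq_zero_or_pos D with h0 | hpos
    · refine ⟨⊥, by rw [h0, finrank_bot], fun α hα hn => ?_⟩
      rw [(Submodule.mem_bot ℂ).1 hα, norm_zero] at hn
      exact absurd hn zero_ne_one
    · have he : ‖(EuclideanSpace.single 0 1 : EuclideanSpace ℂ (Fin d))‖ = 1 := by simp
      have hm1 : 1 - 1 / (2 * (κ : ℝ)) ≤ 1 := sub_le_self _ (by positivity)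
      obtain ⟨V, hV, h⟩ := RemotePrep.exists_submodule_forall_le
        (RemotePrep.isNorming_overlap (κ := κ)) RemotePrep.overlap_le_add_norm_sub
        (fun r α hr => RemotePrep.overlap_smul _ r α hr) he hm1
        (RemotePrep.one_sub_le_integral_overlap he) hε hε1 hm hpos hDle hDd
      exact ⟨V, hV, fun α hα hn => (h α hα hn).trans (RemotePrep.overlap_le_fidelity _ α)⟩
  · obtain ⟨V, hV⟩ := RemotePrep.exists_submodule_finrank_eq (E := EuclideanSpace ℂ (Fin d))
      (n := D) (by rwa [finrank_euclideanSpace_fin])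
    exact ⟨V, hV, fun α _ _ => (by linarith : _ ≤ (0 : ℝ)).trans (Real.sqrt_nonneg _)⟩
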